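/- Let $d\ge 1$, let $(\Omega,\mathcal F,P)$ and $(\mathcal X,\mathcal A,p)$ be probability spaces, and let $W$ be a Gaussian independently scattered random measure on $\mathcal X\times\mathbb R^d$ with control measure $c(dx,ds)=p(dx)\,ds$: for measurable $A$ with $c(A)<\infty$ the variable $W(A)$ has law $N(0,c(A))$, the variables of disjoint sets are independent, and $W$ is almost surely countably additive along each sequence of disjoint sets whose union has finite measure. The first coordinate $s_1$ of $s\in\mathbb R^d$ is regarded as time. Let $(\mathcal F_r)_{r\in\mathbb R}$ be a filtration such that, for every $r$, $W(A)$ is $\mathcal F_r$-measurable if $A\subset\{s_1\le r\}$, and the family of the $W(A)$ with $A\subset\{s_1>r\}$ is independent of $\mathcal F_r$. Let $g:\mathcal X\times\mathbb R^d\to\mathbb R$ be measurable and let $\sigma=(\sigma(s))_{s\in\mathbb R^d}$ be a real, strictly stationary random field, independent of $W$, predictable in the first component $s_1$ with respect to $(\mathcal F_r)$ (jointly measurable in the remaining components), with $$\int_{\mathcal X\times\mathbb R^d}g^2(x,t-s)\,\mathbb E(\sigma^2(s))\,p(dx)\,ds<\infty\qquad\text{for all }t\in\mathbb R^d .$$ Assume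 that $g$ is not $c$-almost everywhere $0$ and that $\sigma(0)$ is not almost surely $0$. Then the volatility modulated mixed moving average field $$X(t)=\int_{\mathcal X\times\mathbb R^d}g(x,t-s)\,\sigma(s)\,W(dx,ds),\qquad t\in\mathbb R^d,$$ exists as a stochastic integral in the sense of Walsh (the $L^2(P)$-limit of the integrals of simple predictable integrands that converge to the integrand in $L^2(c\otimes P)$), and there is a jointly measurable function $\widehat g:\mathcal X\times\mathbb R^d\to\mathbb C$ such that, for $p$-almost every $x$, $g(x,\cdot)\in L^2(\mathbb R^d)$ and $\widehat g(x,\cdot)$ is its $L^2$-Fourier transform, that is, the $L^2$-extension of $f\mapsto(2\pi)^{-d/2}\int_{\mathbb R^d}e^{-iu^\top s}f(s)\,ds$. For every such $X$ and every such $\widehat g$, put $$\gamma(u):=\int_{\mathcal X}|\widehat g(x,u)|^2\,p(dx).$$ Then: 1. $\operatorname{Var}(X(t))>0$ for all $t$; $\gamma(u)<\infty$ for almost every $u$, and $\gamma\in L^1(\mathbb R^d)$. 2. There is a constant $C>0$, not depending on $h$, such that the autocorrelation function $\rho_X(h)=\operatorname{Cor}(X(h),X(0))$ satisfies $$\rho_X(h)=C\,\frac1{(2\pi)^{d/2}}\int_{\mathbb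 R^d}e^{ih^\top u}\gamma(u)\,du\qquad\text{for all }h\in\mathbb R^d.$$ 3. $\gamma$ is proportional to the spectral density of $X$: there is a constant $C>0$ such that a function $f:\mathbb R^d\to\mathbb R$ is a spectral density of $X$ if and only if $f=C\gamma$ almost everywhere. Here $f$ is called a spectral density of $X$ if $X$ has finite second moments and constant mean, $f$ is integrable and almost everywhere nonnegative, and $\operatorname{Cov}(X(t+h),X(t))=\int_{\mathbb R^d}e^{ih^\top u}f(u)\,du$ for all $t,h\in\mathbb R^d$. -/

import Mathlib

open MeasureTheory ProbabilityTheory Filter Topology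
open scoped FourierTransform ENNReal NNReal

namespace VMMMA

section WhiteNoise

variable {Ω S : Type*} [MeasurableSpace Ω] [MeasurableSpace S]

/-- `W` is a Gaussian independently scattered random measure on `S` with control measure `c`,
indexed by the measurable sets of finite `c`-measure: `W A` has law `N(0, c A)`, disjoint sets
give independent variables, and `W` is almost surely countably additive (the series of the
`W (A n)` converges almost surely to the value on the union, as a limit of partial sums). -/
structure IsGaussianWhiteNoise (P : Measure Ω) (c : Measure S) (W : Set S → Ω → ℝ) : Prop where
  measurable : ∀ A, MeasurableSet A → c A < ∞ → Measurable (W A)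
  law : ∀ A, MeasurableSet A → c A < ∞ → P.map (W A) = gaussianReal 0 (c A).toNNReal
  indep : ∀ A : ℕ → Set S, (∀ n, MeasurableSet (A n)) → (∀ n, c (A n) < ∞) →
    Pairwise (fun m n => Disjoint (A m) (A n)) → iIndepFun (fun n => W (A n)) P
  additive : ∀ A : ℕ → Set S, (∀ n, MeasurableSet (A n)) → c (⋃ n, A n) < ∞ →
    Pairwise (fun m n => Disjoint (A m) (A n)) →
    ∀ᵐ ω ∂P, Tendsto (fun N => ∑ n ∈ Finset.range N, W (A n) ω) atTop (𝓝 (W (⋃ n, A n) ω))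

/-- The σ-algebra generated by the variables `W A`, where `A` runs through the measurable sets of
finite measure that are contained in `T`. -/
@[reducible]
def noiseSigma (c : Measure S) (W : Set S → Ω → ℝ) (T : Set S) : MeasurableSpace Ω :=
  ⨆ (A : Set S) (_ : MeasurableSet A ∧ c A < ∞ ∧ A ⊆ T), MeasurableSpace.comap (W A) inferInstance

/-- `F` is a filtration for which `W` is an orthogonal martingale measure in the time variable
`τ : S → ℝ`: the noise up to time `a` is `F a`-measurable, and the noise after time `a` is
independent of `F a`. -/
structure IsNoiseFiltration (P : Measure Ω) (c : Measure S) (W : Set S → Ω → ℝ) (τ : S → ℝ)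
    (F : Filtration ℝ ‹MeasurableSpace Ω›) : Prop where
  adapted : ∀ a, noiseSigma c W {z | τ z ≤ a} ≤ F a
  indep_future : ∀ a, Indep (F a) (noiseSigma c W {z | a < τ z}) P

/-- The predictable σ-algebra on `S × Ω`, with respect to the time variable `τ : S → ℝ`. It is
generated by the sets `(A ∩ {a < τ ≤ b}) × D` with `A` measurable and `D ∈ F a`. -/
@[reducible]
def predictableSigma (τ : S → ℝ) (F : Filtration ℝ ‹MeasurableSpace Ω›) :
    MeasurableSpace (S × Ω) :=
  MeasurableSpace.generateFrom
    {B | ∃ (a b : ℝ) (A : Set S) (D : Set Ω), MeasurableSet A ∧ MeasurableSet[F a] D ∧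
      B = (A ∩ {z | a < τ z ∧ τ z ≤ b}) ×ˢ D}

/-- The data of an elementary predictable integrand `Y(ω) 1_{A ∩ {a < τ ≤ b}}(z)`, with `Y` bounded
and `F a`-measurable and `A` of finite measure. -/
structure Elementary (c : Measure S) (τ : S → ℝ) (F : Filtration ℝ ‹MeasurableSpace Ω›) where
  a : ℝ
  b : ℝ
  A : Set S
  Y : Ω → ℝ
  measurableSet_A : MeasurableSet A
  finite_A : c A < ∞
  measurable_Y : Measurable[F a] Y
  bounded_Y : ∃ K : ℝ, ∀ ω, |Y ω| ≤ K

variable {c : Measure S} {τ : S → ℝ} {F : Filtration ℝ ‹MeasurableSpace Ω›}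

/-- The set that carries an elementary integrand. -/
def Elementary.region (e : Elementary c τ F) : Set S :=
  e.A ∩ {z | e.a < τ z ∧ τ z ≤ e.b}

/-- The value `∑ Y(ω) 1_B(z)` of a simple integrand, a finite sum of elementary ones. -/
noncomputable def simpleFun (φ : List (Elementary c τ F)) (q : S × Ω) : ℝ :=
  (φ.map fun e => e.region.indicator (fun _ => e.Y q.2) q.1).sum

/-- The stochastic integral `∑ Y(ω) W(B)(ω)` of a simple integrand. -/
noncomputable def simpleIntegral (W : Set S → Ω → ℝ) (φ : List (Elementary c τ F)) (ω : Ω) : ℝ :=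
  (φ.map fun e => e.Y ω * W e.region ω).sum

/-- `I` is (a version of) the stochastic integral `∫ Φ(z) W(dz)`, in the sense of Walsh, of the
random integrand `Φ : S × Ω → ℝ`: simple predictable integrands converge to `Φ` in `L²(c ⊗ P)`
and their integrals converge to `I` in `L²(P)`. -/
def IsWalshIntegral (P : Measure Ω) (c : Measure S) (τ : S → ℝ)
    (F : Filtration ℝ ‹MeasurableSpace Ω›) (W : Set S → Ω → ℝ) (Φ : S × Ω → ℝ) (I : Ω → ℝ) :
    Prop :=
  MemLp I 2 P ∧ ∃ φ : ℕ → List (Elementary c τ F),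
    Tendsto (fun n => eLpNorm (fun q => simpleFun (φ n) q - Φ q) 2 (c.prod P)) atTop (𝓝 0) ∧
    Tendsto (fun n => eLpNorm (fun ω => simpleIntegral W (φ n) ω - I ω) 2 P) atTop (𝓝 0)

end WhiteNoise

section Fields

variable {Ω 𝒳 : Type*} [MeasurableSpace Ω] [MeasurableSpace 𝒳] {d : ℕ}

/-- Strict stationarity of a random field on `ℝ^d`: the finite dimensional distributions are
invariant under translations. -/
def IsStrictlyStationary (P : Measure Ω) (Z : EuclideanSpace ℝ (Fin d) → Ω → ℝ) : Prop :=
  ∀ (n : ℕ) (s : Fin n → EuclideanSpace ℝ (Fin d)) (h : EuclideanSpace ℝ (Fin d)),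
    P.map (fun ω i => Z (s i + h) ω) = P.map (fun ω i => Z (s i) ω)

/-- The time coordinate, the first one, of a point of `ℝ^d`. -/
def time [NeZero d] (s : EuclideanSpace ℝ (Fin d)) : ℝ := s 0

/-- `X` is the volatility modulated mixed moving average field
`X(t) = ∫ g(x, t - s) σ(s) W(dx, ds)`. -/
def IsVMMMAField [NeZero d] (P : Measure Ω) (p : Measure 𝒳)
    (F : Filtration ℝ ‹MeasurableSpace Ω›)
    (W : Set (𝒳 × EuclideanSpace ℝ (Fin d)) → Ω → ℝ)
    (g : 𝒳 → EuclideanSpace ℝ (Fin d) → ℝ)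
    (σ : EuclideanSpace ℝ (Fin d) → Ω → ℝ) (X : EuclideanSpace ℝ (Fin d) → Ω → ℝ) : Prop :=
  ∀ t, IsWalshIntegral P (p.prod volume) (fun z => time z.2) F W
    (fun q => g q.1.1 (t - q.1.2) * σ q.1.2 q.2) (X t)

/-- The autocorrelation function `ρ_X(h) = Cor(X(h), X(0))`. -/
noncomputable def autocorrelation (P : Measure Ω) (X : EuclideanSpace ℝ (Fin d) → Ω → ℝ)
    (h : EuclideanSpace ℝ (Fin d)) : ℝ :=
  cov[X h, X 0; P] / (√(Var[X h; P]) * √(Var[X 0; P]))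

/-- `f` is a spectral density of the second-order stationary field `X`: a nonnegative integrable
function with `Cov(X(t + h), X(t)) = ∫ e^{i h·u} f(u) du` for all `t` and `h`. -/
def IsSpectralDensity (P : Measure Ω) (X : EuclideanSpace ℝ (Fin d) → Ω → ℝ)
    (f : EuclideanSpace ℝ (Fin d) → ℝ) : Prop :=
  (∀ t, MemLp (X t) 2 P) ∧ (∀ s t, ∫ ω, X s ω ∂P = ∫ ω, X t ω ∂P) ∧
  (0 ≤ᵐ[volume] f) ∧ Integrable f ∧
  ∀ t h, ((cov[X (t + h), X t; P] : ℝ) : ℂ) =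
    ∫ u, Complex.exp (Complex.I * (inner ℝ h u : ℝ)) * (f u : ℂ)

/-- `fhat` is (a version of) the unitary `L²`-Fourier transform of `f ∈ L²(ℝ^d)`, which for
integrable `f` is `(2π)^{-d/2} ∫ e^{-i u·s} f(s) ds`. Mathlib's transform has the kernel
`e^{-2π i u·s}` and no factor, whence the rescaling. -/
def IsL2FourierTransform (f : EuclideanSpace ℝ (Fin d) → ℝ)
    (fhat : EuclideanSpace ℝ (Fin d) → ℂ) : Prop :=
  ∃ hf : MemLp (fun s => (f s : ℂ)) 2 volume,
    fhat =ᵐ[volume] fun u => (((2 * Real.pi) ^ (-(d : ℝ) / 2) : ℝ) : ℂ) *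
      (𝓕 (hf.toLp (fun s => (f s : ℂ))) : Lp ℂ 2 (volume : Measure (EuclideanSpace ℝ (Fin d))))
        ((2 * Real.pi)⁻¹ • u)

/-- `ghat` is a jointly measurable version of the family of the `L²`-Fourier transforms of the
functions `g(x, ·)`, for `p`-almost every `x`. -/
def IsFourierVersion (p : Measure 𝒳) (g : 𝒳 → EuclideanSpace ℝ (Fin d) → ℝ)
    (ghat : 𝒳 → EuclideanSpace ℝ (Fin d) → ℂ) : Prop :=
  Measurable (Function.uncurry ghat) ∧ ∀ᵐ x ∂p, IsL2FourierTransform (g x) (ghat x)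

/-- `γ(u) = ∫ |ghat(x, u)|² p(dx)`. -/
noncomputable def gam (p : Measure 𝒳) (ghat : 𝒳 → EuclideanSpace ℝ (Fin d) → ℂ)
    (u : EuclideanSpace ℝ (Fin d)) : ℝ :=
  ∫ x, ‖ghat x u‖ ^ 2 ∂p

end Fields

end VMMMA

namespace VMMMA

/-! Everything reduces to the formula `Cov(X(s), X(t)) = M ∫ e^{i(s-t)·u} γ(u) du` with `M = E
σ(0)²`. Its probabilistic half is the Walsh isometry `E[I J] = ∫ Φ Ψ d(c ⊗ P)`
(`IsWalshIntegral.integral_mul`): noise after time `a` is centred and independent of `F a`, so it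
can be averaged against the past. For `Φ = g(x, t - s) σ(s)`, stationarity makes `E σ(s)²` constant,
and the covariance becomes `M ∫ g(x, r) g(x, r + s - t)`. Its analytic half is Plancherel for each
`x`: translation becomes multiplication by a character, so the autocorrelation of `g(x, ·)` is the
Fourier integral of `|ghat(x, ·)|²`; Fubini over `x` then produces `γ`
(`integral_mul_translation_eq`). By stationarity the integrability condition factorizes into `‖g‖² ·
E σ(0)² < ∞`; as neither factor is zero, both are finite, and lag zero gives `Var X(t) = M ∫ γ = M
‖g‖² > 0`. Uniqueness of the spectral density is uniqueness of a finite measure with given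
characteristic function. Existence of `X` needs density of simple integrands in the predictable `L²`
functions (`IsSimpleLimit.of_predictable`); the isometry then carries Cauchy sequences over.
Existence of `ghat` needs a jointly measurable choice of representatives
(`exists_measurable_version`). -/

theorem _root_.MeasureTheory.MemLp.integrable_fun_mul {α : Type*} {m : MeasurableSpace α}
    {μ : Measure α}
    {f g : α → ℝ} (hf : MemLp f 2 μ) (hg : MemLp g 2 μ) : Integrable (fun x => f x * g x) μ :=
  hf.integrable_mul hg

/-! ### Second moments of the white noise -/

section WhiteNoiseMoments

variable {Ω S : Type*} [MeasurableSpace Ω] [MeasurableSpace S] {P : Measure Ω} {c : Measure S}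
  {W : Set S → Ω → ℝ}

namespace IsGaussianWhiteNoise

theorem memLp_two (hW : IsGaussianWhiteNoise P c W) {A : Set S} (hA : MeasurableSet A)
    (hc : c A < ∞) : MemLp (W A) 2 P := by
  have h : MemLp (id : ℝ → ℝ) ((2 : ℝ≥0) : ℝ≥0∞) (P.map (W A)) := by
    rw [hW.law A hA hc]; exact memLp_id_gaussianReal 2
  exact (memLp_map_measure_iff (by fun_prop) (hW.measurable A hA hc).aemeasurable).1 h

theorem integral_eq_zero (hW : IsGaussianWhiteNoise P c W) {A : Set S} (hA : MeasurableSet A)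
    (hc : c A < ∞) : ∫ ω, W A ω ∂P = 0 := by
  have h : ∫ x, x ∂(P.map (W A)) = 0 := by
    rw [hW.law A hA hc, integral_id_gaussianReal]
  rwa [integral_map (hW.measurable A hA hc).aemeasurable (by fun_prop)] at h

theorem integral_sq (hW : IsGaussianWhiteNoise P c W) [IsProbabilityMeasure P] {A : Set S}
    (hA : MeasurableSet A) (hc : c A < ∞) : ∫ ω, W A ω * W A ω ∂P = c.real A := by
  have h : Var[id; P.map (W A)] = c.real A := by
    rw [hW.law A hA hc, variance_id_gaussianReal]; rfl
  rw [variance_map (by fun_prop) (hW.measurable A hA hc).aemeasurable, Function.id_comp,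
    variance_eq_sub (hW.memLp_two hA hc), hW.integral_eq_zero hA hc] at h
  rw [← h]
  simp [pow_two]

theorem empty_ae_eq_zero (hW : IsGaussianWhiteNoise P c W) : ∀ᵐ ω ∂P, W ∅ ω = 0 := by
  have h := hW.law ∅ MeasurableSet.empty (by simp)
  have hm := hW.measurable ∅ MeasurableSet.empty (by simp)
  simp only [measure_empty, ENNReal.toNNReal_zero, gaussianReal_zero_var] at h
  have h0 : ∀ᵐ x ∂(P.map (W ∅)), x = 0 := by rw [h, ae_dirac_eq]; simp
  exact ae_of_ae_map hm.aemeasurable h0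

theorem indepFun_of_disjoint (hW : IsGaussianWhiteNoise P c W) {A B : Set S}
    (hA : MeasurableSet A) (hB : MeasurableSet B) (hcA : c A < ∞) (hcB : c B < ∞)
    (hAB : Disjoint A B) : IndepFun (W A) (W B) P := by
  let s : ℕ → Set S := fun n => if n = 0 then A else if n = 1 then B else ∅
  have hs : Pairwise (fun m n => Disjoint (s m) (s n)) := by
    intro m n hmn
    simp only [s]
    split_ifs <;> simp_all [hAB.symm]
  have h := hW.indep s (fun n => by simp only [s]; split_ifs <;> simp [*])
    (fun n => by simp only [s]; split_ifs <;> simp [*]) hs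
  exact h.indepFun (i := 0) (j := 1) (by simp)

/-- Countable additivity for `A, B, ∅, ∅, …`: since `W ∅` has law `N(0, 0)`, it vanishes almost
surely, and the partial sums are constant from the second on. -/
theorem union_ae_eq_add (hW : IsGaussianWhiteNoise P c W) {A B : Set S}
    (hA : MeasurableSet A) (hB : MeasurableSet B) (hcA : c A < ∞) (hcB : c B < ∞)
    (hAB : Disjoint A B) : ∀ᵐ ω ∂P, W (A ∪ B) ω = W A ω + W B ω := by
  let s : ℕ → Set S := fun n => if n = 0 then A else if n = 1 then B else ∅
  have hs : Pairwise (fun m n => Disjoint (s m) (s n)) := by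
    intro m n hmn
    simp only [s]
    split_ifs <;> simp_all [hAB.symm]
  have hU : ⋃ n, s n = A ∪ B := by
    ext x
    simp only [Set.mem_iUnion, Set.mem_union, s]
    constructor
    · rintro ⟨n, hn⟩
      split_ifs at hn <;> simp_all
    · rintro (h | h)
      · exact ⟨0, by simpa using h⟩
      · exact ⟨1, by simpa using h⟩
  have h := hW.additive s (fun n => by simp only [s]; split_ifs <;> simp [*])
    (by rw [hU]; exact measure_union_lt_top hcA hcB) hs
  filter_upwards [h, hW.empty_ae_eq_zero] with ω h1 h2
  rw [hU] at h1
  refine tendsto_nhds_unique h1 (tendsto_const_nhds.congr' ?_)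
  filter_upwards [eventually_ge_atTop 2] with N hN
  obtain ⟨k, rfl⟩ := Nat.exists_eq_add_of_le' hN
  induction k with
  | zero => simp [Finset.sum_range_succ, s]
  | succ k ih =>
    rw [show k + 1 + 2 = (k + 2) + 1 by ring, Finset.sum_range_succ, ← ih (by omega)]
    simp [s, h2]

/-- Both sets are split along `A ∩ B`. Of the four products only the square of `W (A ∩ B)` survives;
the others involve disjoint sets, hence independent centred variables. -/
theorem integral_mul (hW : IsGaussianWhiteNoise P c W) [IsProbabilityMeasure P] {A B : Set S}
    (hA : MeasurableSet A) (hB : MeasurableSet B) (hcA : c A < ∞) (hcB : c B < ∞) :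
    ∫ ω, W A ω * W B ω ∂P = c.real (A ∩ B) := by
  have hI := hA.inter hB
  have hcI : c (A ∩ B) < ∞ := (measure_mono Set.inter_subset_left).trans_lt hcA
  have hcA' : c (A \ B) < ∞ := (measure_mono Set.sdiff_subset).trans_lt hcA
  have hcB' : c (B \ A) < ∞ := (measure_mono Set.sdiff_subset).trans_lt hcB
  have h1 := hW.union_ae_eq_add hI (hA.diff hB) hcI hcA'
    (Set.disjoint_sdiff_right.mono_left Set.inter_subset_right)
  have h2 := hW.union_ae_eq_add hI (hB.diff hA) hcI hcB'
    (Set.disjoint_sdiff_right.mono_left Set.inter_subset_left)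
  rw [Set.inter_union_sdiff] at h1
  rw [Set.inter_comm, Set.inter_union_sdiff, Set.inter_comm] at h2
  have mI := hW.memLp_two hI hcI
  have mA := hW.memLp_two (hA.diff hB) hcA'
  have mB := hW.memLp_two (hB.diff hA) hcB'
  have key : ∀ {C D : Set S}, MeasurableSet C → MeasurableSet D → c C < ∞ → c D < ∞ →
      Disjoint C D → ∫ ω, W C ω * W D ω ∂P = 0 := by
    intro C D hC hD hcC hcD hCD
    rw [(hW.indepFun_of_disjoint hC hD hcC hcD hCD).integral_fun_mul_eq_mul_integral
      (hW.measurable C hC hcC).aestronglyMeasurable (hW.measurable D hD hcD).aestronglyMeasurable,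
      hW.integral_eq_zero hC hcC, zero_mul]
  have e : (fun ω => W A ω * W B ω) =ᵐ[P] fun ω =>
      (W (A ∩ B) ω * W (A ∩ B) ω + W (A ∩ B) ω * W (B \ A) ω) +
      (W (A \ B) ω * W (A ∩ B) ω + W (A \ B) ω * W (B \ A) ω) := by
    filter_upwards [h1, h2] with ω a b
    rw [a, b]; ring
  have i1 : Integrable (fun ω => W (A ∩ B) ω * W (A ∩ B) ω) P := mI.integrable_mul mI
  have i2 : Integrable (fun ω => W (A ∩ B) ω * W (B \ A) ω) P := mI.integrable_mul mB
  have i3 : Integrable (fun ω => W (A \ B) ω * W (A ∩ B) ω) P := mA.integrable_mul mI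
  have i4 : Integrable (fun ω => W (A \ B) ω * W (B \ A) ω) P := mA.integrable_mul mB
  have i12 : Integrable (fun ω => W (A ∩ B) ω * W (A ∩ B) ω + W (A ∩ B) ω * W (B \ A) ω) P :=
    i1.add i2
  have i34 : Integrable (fun ω => W (A \ B) ω * W (A ∩ B) ω + W (A \ B) ω * W (B \ A) ω) P :=
    i3.add i4
  rw [integral_congr_ae e, integral_add i12 i34, integral_add i1 i2, integral_add i3 i4,
        hW.integral_sq hI hcI,
    key hI (hB.diff hA) hcI hcB' (Set.disjoint_sdiff_right.mono_left Set.inter_subset_left),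
    key (hA.diff hB) hI hcA' hcI
      (Set.disjoint_sdiff_left.mono_right Set.inter_subset_right),
    key (hA.diff hB) (hB.diff hA) hcA' hcB'
      (Set.disjoint_sdiff_left.mono_right Set.sdiff_subset)]
  ring

end IsGaussianWhiteNoise

end WhiteNoiseMoments

theorem measurable_noiseSigma {Ω S : Type*} [MeasurableSpace S] {c : Measure S}
    {W : Set S → Ω → ℝ} {T A : Set S} (hA : MeasurableSet A) (hc : c A < ∞) (hAT : A ⊆ T) :
    Measurable[noiseSigma c W T] (W A) := by
  have h : MeasurableSpace.comap (W A) inferInstance ≤ noiseSigma c W T :=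
    le_iSup₂_of_le (f := fun (A : Set S) (_ : MeasurableSet A ∧ c A < ∞ ∧ A ⊆ T) =>
      MeasurableSpace.comap (W A) inferInstance) A ⟨hA, hc, hAT⟩ le_rfl
  exact (Measurable.of_comap_le h)

/-! ### The isometry for simple integrands -/

section SimpleIntegrands

variable {Ω S : Type*} [MeasurableSpace Ω] [MeasurableSpace S] {P : Measure Ω} {c : Measure S}
  {W : Set S → Ω → ℝ} {τ : S → ℝ} {F : Filtration ℝ ‹MeasurableSpace Ω›}

namespace IsNoiseFiltration

theorem indepFun (hF : IsNoiseFiltration P c W τ F) {a : ℝ} {U : Ω → ℝ}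
    (hU : Measurable[F a] U) {A : Set S} (hA : MeasurableSet A) (hc : c A < ∞)
    (hAa : ∀ z ∈ A, a < τ z) : IndepFun U (W A) P := by
  have h := hF.indep_future a
  refine indep_of_indep_of_le_left (indep_of_indep_of_le_right h ?_) hU.comap_le
  exact (measurable_noiseSigma hA hc hAa).comap_le

theorem indepFun_mul (hF : IsNoiseFiltration P c W τ F) {a : ℝ} {U : Ω → ℝ}
    (hU : Measurable[F a] U) {A B : Set S} (hA : MeasurableSet A) (hcA : c A < ∞)
    (hAa : ∀ z ∈ A, a < τ z) (hB : MeasurableSet B) (hcB : c B < ∞) (hBa : ∀ z ∈ B, a < τ z) :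
    IndepFun U (fun ω => W A ω * W B ω) P := by
  have h := hF.indep_future a
  refine indep_of_indep_of_le_left (indep_of_indep_of_le_right h ?_) hU.comap_le
  exact ((measurable_noiseSigma hA hcA hAa).mul (measurable_noiseSigma hB hcB hBa)).comap_le

end IsNoiseFiltration

namespace Elementary

theorem measurableSet_region (hτ : Measurable τ) (e : Elementary c τ F) :
    MeasurableSet e.region :=
  e.measurableSet_A.inter
    ((measurableSet_lt measurable_const hτ).inter (measurableSet_le hτ measurable_const))

theorem measure_region_lt_top (e : Elementary c τ F) : c e.region < ∞ :=
  (measure_mono Set.inter_subset_left).trans_lt e.finite_A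

theorem measurable (e : Elementary c τ F) : Measurable e.Y := e.measurable_Y.mono (F.le _) le_rfl

theorem memLp_mul_noise [IsProbabilityMeasure P] (hτ : Measurable τ)
    (hW : IsGaussianWhiteNoise P c W) (e : Elementary c τ F) :
    MemLp (fun ω => e.Y ω * W e.region ω) 2 P := by
  obtain ⟨K, hK⟩ := e.bounded_Y
  exact MemLp.of_le_mul (c := K) (hW.memLp_two (e.measurableSet_region hτ) e.measure_region_lt_top)
    (e.measurable.mul (hW.measurable _ (e.measurableSet_region hτ)
      e.measure_region_lt_top)).aestronglyMeasurable
    (ae_of_all _ fun ω => by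
      rw [norm_mul]
      exact mul_le_mul_of_nonneg_right (hK ω) (norm_nonneg _))

theorem memLp_indicator [IsProbabilityMeasure P] (hτ : Measurable τ) (e : Elementary c τ F) :
    MemLp (fun q : S × Ω => e.region.indicator (fun _ => e.Y q.2) q.1) 2 (c.prod P) := by
  obtain ⟨K, hK⟩ := e.bounded_Y
  have hR := e.measurableSet_region hτ
  have h1 : MemLp ((e.region ×ˢ (Set.univ : Set Ω)).indicator fun _ => (1 : ℝ)) 2 (c.prod P) :=
    memLp_indicator_const 2 (hR.prod MeasurableSet.univ) 1
      (Or.inr (by simpa [Measure.prod_prod] using e.measure_region_lt_top.ne))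
  have h2 : (fun q : S × Ω => e.region.indicator (fun _ => e.Y q.2) q.1) =
      (e.region ×ˢ (Set.univ : Set Ω)).indicator fun q => e.Y q.2 := by
    ext q
    by_cases h : q.1 ∈ e.region <;> simp [h]
  rw [h2]
  refine MemLp.of_le_mul (c := K) h1
    ((e.measurable.comp measurable_snd).indicator
      (hR.prod MeasurableSet.univ)).aestronglyMeasurable (ae_of_all _ fun q => ?_)
  by_cases h : q.1 ∈ e.region
  · simpa [h] using hK q.2
  · simp [h]

theorem integral_mul_noise (hτ : Measurable τ) (hW : IsGaussianWhiteNoise P c W)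
    (hF : IsNoiseFiltration P c W τ F) (e : Elementary c τ F) :
    ∫ ω, e.Y ω * W e.region ω ∂P = 0 := by
  have hR := e.measurableSet_region hτ
  have hc := e.measure_region_lt_top
  rw [(hF.indepFun e.measurable_Y hR hc fun z hz => hz.2.1).integral_fun_mul_eq_mul_integral
    e.measurable.aestronglyMeasurable (hW.measurable _ hR hc).aestronglyMeasurable,
    hW.integral_eq_zero hR hc, mul_zero]

theorem integral_indicator_mul [IsProbabilityMeasure P] [SFinite c] (hτ : Measurable τ)
    (e e' : Elementary c τ F) :
    ∫ q : S × Ω, e.region.indicator (fun _ => e.Y q.2) q.1 *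
      e'.region.indicator (fun _ => e'.Y q.2) q.1 ∂(c.prod P) =
      c.real (e.region ∩ e'.region) * ∫ ω, e.Y ω * e'.Y ω ∂P := by
  have h : ∀ q : S × Ω, e.region.indicator (fun _ => e.Y q.2) q.1 *
      e'.region.indicator (fun _ => e'.Y q.2) q.1 =
      (e.region ∩ e'.region).indicator (fun _ => (1 : ℝ)) q.1 * (e.Y q.2 * e'.Y q.2) := by
    intro q
    by_cases h1 : q.1 ∈ e.region <;> by_cases h2 : q.1 ∈ e'.region <;> simp [h1, h2]
  simp_rw [h]
  rw [integral_prod_mul (fun z => (e.region ∩ e'.region).indicator (fun _ => (1 : ℝ)) z)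
    (fun ω => e.Y ω * e'.Y ω), integral_indicator_const _
    ((e.measurableSet_region hτ).inter (e'.measurableSet_region hτ))]
  simp

/-- The region of `e` is cut at the later starting time `e'.a`. The early part `B₁`, together with
both coefficients, is known at time `e'.a`, and the centred `W e'.region` is independent of it, so
its contribution is zero. For the late part `B₂` both noise variables lie in the future, and the
coefficients separate from their product. -/
theorem integral_noise_mul_of_le [IsProbabilityMeasure P] (hτ : Measurable τ)
    (hW : IsGaussianWhiteNoise P c W) (hF : IsNoiseFiltration P c W τ F)
    (e e' : Elementary c τ F) (hle : e.a ≤ e'.a) :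
    ∫ ω, (e.Y ω * W e.region ω) * (e'.Y ω * W e'.region ω) ∂P =
      c.real (e.region ∩ e'.region) * ∫ ω, e.Y ω * e'.Y ω ∂P := by
  have hR := e.measurableSet_region hτ
  have hc := e.measure_region_lt_top
  have hR' := e'.measurableSet_region hτ
  have hc' := e'.measure_region_lt_top
  set B₁ := e.region ∩ {z | τ z ≤ e'.a} with hB₁
  set B₂ := e.region ∩ {z | e'.a < τ z} with hB₂
  have m₁ : MeasurableSet B₁ := hR.inter (measurableSet_le hτ measurable_const)
  have m₂ : MeasurableSet B₂ := hR.inter (measurableSet_lt measurable_const hτ)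
  have c₁ : c B₁ < ∞ := (measure_mono Set.inter_subset_left).trans_lt hc
  have c₂ : c B₂ < ∞ := (measure_mono Set.inter_subset_left).trans_lt hc
  have hU : B₁ ∪ B₂ = e.region := by
    rw [hB₁, hB₂, ← Set.inter_union_distrib_left, Set.inter_eq_left]
    exact fun z _ => le_or_gt (τ z) e'.a
  have hd : Disjoint B₁ B₂ := by
    rw [Set.disjoint_left]
    exact fun z h1 h2 => absurd (show e'.a < τ z from h2.2) (not_lt.2 h1.2)
  have hadd := hW.union_ae_eq_add m₁ m₂ c₁ c₂ hd
  rw [hU] at hadd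
  -- The region of `e'` lies entirely after `e'.a`, so the cut loses nothing of the overlap.
  have hB2 : B₂ ∩ e'.region = e.region ∩ e'.region := by
    ext z
    exact ⟨fun h => ⟨h.1.1, h.2⟩, fun h => ⟨⟨h.1, h.2.2.1⟩, h.2⟩⟩
  have hY : Measurable[F e'.a] e.Y := e.measurable_Y.mono (F.mono hle) le_rfl
  have hYY : Measurable[F e'.a] fun ω => e.Y ω * e'.Y ω := hY.mul e'.measurable_Y
  have hW₁ : Measurable[F e'.a] (W B₁) :=
    (measurable_noiseSigma m₁ c₁ Set.inter_subset_right).mono (hF.adapted _) le_rfl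
  have hV : Measurable[F e'.a] fun ω => e.Y ω * e'.Y ω * W B₁ ω := hYY.mul hW₁
  have hYY' : Measurable fun ω => e.Y ω * e'.Y ω := e.measurable.mul e'.measurable
  obtain ⟨K, hK⟩ := e.bounded_Y
  obtain ⟨K', hK'⟩ := e'.bounded_Y
  have hb : ∀ᵐ ω ∂P, ‖e.Y ω * e'.Y ω‖ ≤ K * K' := ae_of_all _ fun ω => by
    rw [norm_mul]
    exact mul_le_mul (hK ω) (hK' ω) (norm_nonneg _) ((abs_nonneg _).trans (hK ω))
  have i₁ : Integrable (fun ω => W B₁ ω * W e'.region ω) P :=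
    (hW.memLp_two m₁ c₁).integrable_mul (hW.memLp_two hR' hc')
  have i₂ : Integrable (fun ω => W B₂ ω * W e'.region ω) P :=
    (hW.memLp_two m₂ c₂).integrable_mul (hW.memLp_two hR' hc')
  have j₁ := i₁.bdd_mul hYY'.aestronglyMeasurable hb
  have j₂ := i₂.bdd_mul hYY'.aestronglyMeasurable hb
  have e1 : (fun ω => (e.Y ω * W e.region ω) * (e'.Y ω * W e'.region ω)) =ᵐ[P] fun ω =>
      e.Y ω * e'.Y ω * (W B₁ ω * W e'.region ω) + e.Y ω * e'.Y ω * (W B₂ ω * W e'.region ω) := by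
    filter_upwards [hadd] with ω h
    rw [h]; ring
  rw [integral_congr_ae e1, integral_add j₁ j₂]
  have t1 : ∫ ω, e.Y ω * e'.Y ω * (W B₁ ω * W e'.region ω) ∂P = 0 := by
    simp_rw [← mul_assoc]
    rw [(hF.indepFun hV hR' hc' fun z hz => hz.2.1).integral_fun_mul_eq_mul_integral
      (hYY'.mul (hW.measurable _ m₁ c₁)).aestronglyMeasurable
      (hW.measurable _ hR' hc').aestronglyMeasurable, hW.integral_eq_zero hR' hc', mul_zero]
  have t2 : ∫ ω, e.Y ω * e'.Y ω * (W B₂ ω * W e'.region ω) ∂P =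
      (∫ ω, e.Y ω * e'.Y ω ∂P) * c.real (e.region ∩ e'.region) := by
    rw [(hF.indepFun_mul hYY m₂ c₂ (fun z hz => hz.2) hR' hc'
      fun z hz => hz.2.1).integral_fun_mul_eq_mul_integral hYY'.aestronglyMeasurable
      ((hW.measurable _ m₂ c₂).mul (hW.measurable _ hR' hc')).aestronglyMeasurable,
      hW.integral_mul m₂ hR' c₂ hc', hB2]
  rw [t1, t2, zero_add, mul_comm]

theorem integral_noise_mul [IsProbabilityMeasure P] [SFinite c] (hτ : Measurable τ)
    (hW : IsGaussianWhiteNoise P c W) (hF : IsNoiseFiltration P c W τ F)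
    (e e' : Elementary c τ F) :
    ∫ ω, (e.Y ω * W e.region ω) * (e'.Y ω * W e'.region ω) ∂P =
      ∫ q : S × Ω, e.region.indicator (fun _ => e.Y q.2) q.1 *
        e'.region.indicator (fun _ => e'.Y q.2) q.1 ∂(c.prod P) := by
  rw [integral_indicator_mul hτ]
  rcases le_total e.a e'.a with h | h
  · exact integral_noise_mul_of_le hτ hW hF e e' h
  · have := integral_noise_mul_of_le hτ hW hF e' e h
    rw [Set.inter_comm, integral_congr_ae (ae_of_all _ fun ω => mul_comm (e.Y ω) (e'.Y ω)), ← this]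
    exact integral_congr_ae (ae_of_all _ fun ω => mul_comm _ _)

end Elementary

theorem simpleFun_cons (e : Elementary c τ F) (φ : List (Elementary c τ F)) (q : S × Ω) :
    simpleFun (e :: φ) q = e.region.indicator (fun _ => e.Y q.2) q.1 + simpleFun φ q := by
  simp [simpleFun]

theorem simpleIntegral_cons (e : Elementary c τ F) (φ : List (Elementary c τ F)) (ω : Ω) :
    simpleIntegral W (e :: φ) ω = e.Y ω * W e.region ω + simpleIntegral W φ ω := by
  simp [simpleIntegral]

theorem memLp_simpleFun [IsProbabilityMeasure P] (hτ : Measurable τ)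
    (φ : List (Elementary c τ F)) : MemLp (simpleFun φ) 2 (c.prod P) := by
  induction φ with
  | nil => exact MemLp.zero
  | cons e φ ih => exact (funext (simpleFun_cons e φ)) ▸ (e.memLp_indicator hτ).add ih

theorem memLp_simpleIntegral [IsProbabilityMeasure P] (hτ : Measurable τ)
    (hW : IsGaussianWhiteNoise P c W) (φ : List (Elementary c τ F)) :
    MemLp (simpleIntegral W φ) 2 P := by
  induction φ with
  | nil => exact MemLp.zero
  | cons e φ ih =>
    exact (funext (simpleIntegral_cons (W := W) e φ)) ▸ (e.memLp_mul_noise hτ hW).add ih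

theorem integral_simpleIntegral [IsProbabilityMeasure P] (hτ : Measurable τ)
    (hW : IsGaussianWhiteNoise P c W) (hF : IsNoiseFiltration P c W τ F)
    (φ : List (Elementary c τ F)) : ∫ ω, simpleIntegral W φ ω ∂P = 0 := by
  induction φ with
  | nil => simp [simpleIntegral]
  | cons e φ ih =>
    simp_rw [simpleIntegral_cons]
    rw [integral_add ((e.memLp_mul_noise hτ hW).integrable (by norm_num))
      ((memLp_simpleIntegral hτ hW φ).integrable (by norm_num)), ih,
      e.integral_mul_noise hτ hW hF, add_zero]

/-- Bilinearity reduces the claim to pairs of elementary integrands, so overlapping regions need no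
common refinement. -/
theorem integral_simpleIntegral_mul [IsProbabilityMeasure P] [SFinite c] (hτ : Measurable τ)
    (hW : IsGaussianWhiteNoise P c W) (hF : IsNoiseFiltration P c W τ F)
    (φ ψ : List (Elementary c τ F)) :
    ∫ ω, simpleIntegral W φ ω * simpleIntegral W ψ ω ∂P =
      ∫ q, simpleFun φ q * simpleFun ψ q ∂(c.prod P) := by
  induction φ with
  | nil => simp [simpleIntegral, simpleFun]
  | cons e φ ih =>
    simp_rw [simpleIntegral_cons, simpleFun_cons, add_mul]
    rw [integral_add ((e.memLp_mul_noise hτ hW).integrable_fun_mul (memLp_simpleIntegral hτ hW ψ))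
      ((memLp_simpleIntegral hτ hW φ).integrable_fun_mul (memLp_simpleIntegral hτ hW ψ)),
      integral_add ((e.memLp_indicator hτ).integrable_fun_mul (memLp_simpleFun hτ ψ))
      ((memLp_simpleFun hτ φ).integrable_fun_mul (memLp_simpleFun hτ ψ)), ih]
    congr 1
    clear ih
    induction ψ with
    | nil => simp [simpleIntegral, simpleFun]
    | cons e' ψ ih =>
      simp_rw [simpleIntegral_cons, simpleFun_cons, mul_add]
      rw [integral_add ((e.memLp_mul_noise hτ hW).integrable_fun_mul (e'.memLp_mul_noise hτ hW))
        ((e.memLp_mul_noise hτ hW).integrable_fun_mul (memLp_simpleIntegral hτ hW ψ)),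
        integral_add ((e.memLp_indicator hτ).integrable_fun_mul (e'.memLp_indicator hτ))
        ((e.memLp_indicator hτ).integrable_fun_mul (memLp_simpleFun hτ ψ)), ih,
        Elementary.integral_noise_mul hτ hW hF]

end SimpleIntegrands

theorem prod_univ_eq_iUnion_time_slab {Ω S : Type*} (A : Set S) (τ : S → ℝ) :
    A ×ˢ (Set.univ : Set Ω) =
      ⋃ n : ℕ, (A ∩ {z | -(n : ℝ) < τ z ∧ τ z ≤ n}) ×ˢ (Set.univ : Set Ω) := by
  ext q
  simp only [Set.mem_prod, Set.mem_univ, and_true, Set.mem_iUnion, Set.mem_inter_iff,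
    Set.mem_ofPred_eq, exists_and_left, iff_self_and]
  intro _
  obtain ⟨n, hn⟩ := exists_nat_gt |τ q.1|
  exact ⟨n, (abs_lt.1 hn).1, (abs_lt.1 hn).2.le⟩

/-! ### Density of simple integrands among predictable ones -/

section Density

variable {Ω S : Type*} [MeasurableSpace Ω] [MeasurableSpace S] {P : Measure Ω} {c : Measure S}
  {W : Set S → Ω → ℝ} {τ : S → ℝ} {F : Filtration ℝ ‹MeasurableSpace Ω›}

theorem simpleFun_append (φ ψ : List (Elementary c τ F)) (q : S × Ω) :
    simpleFun (φ ++ ψ) q = simpleFun φ q + simpleFun ψ q := by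
  simp [simpleFun]

/-- The multiple of an elementary integrand by a constant. -/
def Elementary.smul (k : ℝ) (e : Elementary c τ F) : Elementary c τ F where
  a := e.a
  b := e.b
  A := e.A
  Y := fun ω => k * e.Y ω
  measurableSet_A := e.measurableSet_A
  finite_A := e.finite_A
  measurable_Y := e.measurable_Y.const_mul k
  bounded_Y := by
    obtain ⟨K, hK⟩ := e.bounded_Y
    exact ⟨|k| * K, fun ω => by
      rw [abs_mul]; exact mul_le_mul_of_nonneg_left (hK ω) (abs_nonneg k)⟩

theorem simpleFun_map_smul (k : ℝ) (φ : List (Elementary c τ F)) (q : S × Ω) :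
    simpleFun (φ.map (Elementary.smul k)) q = k * simpleFun φ q := by
  induction φ with
  | nil => simp [simpleFun]
  | cons e φ ih =>
    rw [List.map_cons, simpleFun_cons, simpleFun_cons, ih, mul_add]
    congr 1
    by_cases h : q.1 ∈ e.region
    · have h' : q.1 ∈ (e.smul k).region := h
      rw [Set.indicator_of_mem h, Set.indicator_of_mem h']
      rfl
    · have h' : q.1 ∉ (e.smul k).region := h
      simp [h, h']

/-- `f` is a limit in `L²(c ⊗ P)` of simple predictable integrands. -/
def IsSimpleLimit (P : Measure Ω) (c : Measure S) (τ : S → ℝ)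
    (F : Filtration ℝ ‹MeasurableSpace Ω›) (f : S × Ω → ℝ) : Prop :=
  AEStronglyMeasurable f (c.prod P) ∧ ∀ ε : ℝ≥0∞, ε ≠ 0 →
    ∃ φ : List (Elementary c τ F), eLpNorm (simpleFun φ - f) 2 (c.prod P) ≤ ε

namespace IsSimpleLimit

theorem const_mul {f : S × Ω → ℝ} (hf : IsSimpleLimit P c τ F f) (k : ℝ) :
    IsSimpleLimit P c τ F (fun q => k * f q) := by
  refine ⟨hf.1.const_mul k, fun ε hε => ?_⟩
  -- For `k = 0` the tolerance is `ε / 0 = ∞`, and the final bound still holds because `0 * ∞ = 0`.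
  obtain ⟨φ, hφ⟩ := hf.2 (ε / ‖k‖ₑ) (ENNReal.div_pos hε (by simp)).ne'
  refine ⟨φ.map (Elementary.smul k), ?_⟩
  have h : simpleFun (φ.map (Elementary.smul k)) - (fun q => k * f q) =
      k • (simpleFun φ - f) := by
    ext q
    simp only [Pi.sub_apply, Pi.smul_apply, smul_eq_mul, simpleFun_map_smul]
    ring
  rw [h, eLpNorm_const_smul]
  exact (mul_le_mul_right hφ _).trans ENNReal.mul_div_le

variable [IsProbabilityMeasure P]

theorem of_simpleFun (hτ : Measurable τ) (φ : List (Elementary c τ F)) :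
    IsSimpleLimit P c τ F (simpleFun φ) :=
  ⟨(memLp_simpleFun hτ φ).1, fun ε _ => ⟨φ, by simp⟩⟩

theorem add (hτ : Measurable τ) {f f' : S × Ω → ℝ} (hf : IsSimpleLimit P c τ F f)
    (hf' : IsSimpleLimit P c τ F f') : IsSimpleLimit P c τ F (f + f') := by
  refine ⟨hf.1.add hf'.1, fun ε hε => ?_⟩
  obtain ⟨φ, hφ⟩ := hf.2 (ε / 2) (ENNReal.half_pos hε).ne'
  obtain ⟨ψ, hψ⟩ := hf'.2 (ε / 2) (ENNReal.half_pos hε).ne'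
  refine ⟨φ ++ ψ, ?_⟩
  have h : simpleFun (φ ++ ψ) - (f + f') = (simpleFun φ - f) + (simpleFun ψ - f') := by
    ext q
    simp only [Pi.sub_apply, Pi.add_apply, simpleFun_append]
    ring
  rw [h, ← ENNReal.add_halves ε]
  exact (eLpNorm_add_le ((memLp_simpleFun hτ φ).1.sub hf.1) ((memLp_simpleFun hτ ψ).1.sub hf'.1)
    (by norm_num)).trans (add_le_add hφ hψ)

theorem of_forall_exists (hτ : Measurable τ) {f : S × Ω → ℝ}
    (hf : AEStronglyMeasurable f (c.prod P))
    (h : ∀ ε : ℝ≥0∞, ε ≠ 0 → ∃ f', IsSimpleLimit P c τ F f' ∧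
      eLpNorm (f' - f) 2 (c.prod P) ≤ ε) : IsSimpleLimit P c τ F f := by
  refine ⟨hf, fun ε hε => ?_⟩
  obtain ⟨f', hf', h'⟩ := h (ε / 2) (ENNReal.half_pos hε).ne'
  obtain ⟨φ, hφ⟩ := hf'.2 (ε / 2) (ENNReal.half_pos hε).ne'
  refine ⟨φ, ?_⟩
  rw [← sub_add_sub_cancel (simpleFun φ) f' f, ← ENNReal.add_halves ε]
  exact (eLpNorm_add_le ((memLp_simpleFun hτ φ).1.sub hf'.1) (hf'.1.sub hf)
    (by norm_num)).trans (add_le_add hφ h')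

/-- The `L²` error is the square root of the measure of the remainder, which tends to zero because
the union has finite measure. -/
theorem indicator_iUnion_of_monotone (hτ : Measurable τ) {s : ℕ → Set (S × Ω)}
    (hs : ∀ n, MeasurableSet (s n)) (hmono : Monotone s) (hfin : (c.prod P) (⋃ n, s n) < ∞)
    (h : ∀ n, IsSimpleLimit P c τ F ((s n).indicator fun _ => 1)) :
    IsSimpleLimit P c τ F ((⋃ n, s n).indicator fun _ => 1) := by
  have hU : MeasurableSet (⋃ n, s n) := MeasurableSet.iUnion hs
  refine of_forall_exists hτ (measurable_const.indicator hU).aestronglyMeasurable fun ε hε => ?_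
  have ht : Tendsto (fun n => (c.prod P) ((⋃ n, s n) \ s n)) atTop (𝓝 0) := by
    have h1 := ENNReal.Tendsto.sub (tendsto_const_nhds (x := (c.prod P) (⋃ n, s n)))
      (tendsto_measure_iUnion_atTop (μ := c.prod P) hmono) (Or.inl hfin.ne)
    rw [tsub_self] at h1
    refine h1.congr fun n => ?_
    rw [measure_sdiff (Set.subset_iUnion s n) (hs n).nullMeasurableSet
      ((measure_mono (Set.subset_iUnion s n)).trans_lt hfin).ne]
    rfl
  have ht2 : Tendsto (fun n => (c.prod P) ((⋃ n, s n) \ s n) ^ (1 / (2 : ℝ≥0∞).toReal)) atTop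
      (𝓝 0) := by
    have := ht.ennrpow_const (1 / (2 : ℝ≥0∞).toReal)
    rwa [ENNReal.zero_rpow_of_pos (by norm_num)] at this
  obtain ⟨n, hn⟩ := (ht2.eventually (ge_mem_nhds (pos_iff_ne_zero.2 hε))).exists
  refine ⟨_, h n, ?_⟩
  have hd : ((s n).indicator fun _ => (1 : ℝ)) - ((⋃ n, s n).indicator fun _ => 1) =
      -(((⋃ n, s n) \ s n).indicator fun _ => 1) := by
    rw [Set.indicator_sdiff (Set.subset_iUnion s n), neg_sub]
  rw [hd, eLpNorm_neg, eLpNorm_indicator_const (hU.diff (hs n)) (by norm_num) (by norm_num)]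
  simpa using hn

theorem sub_indicator (hτ : Measurable τ) {f f' : S × Ω → ℝ} (hf : IsSimpleLimit P c τ F f)
    (hf' : IsSimpleLimit P c τ F f') : IsSimpleLimit P c τ F (f - f') := by
  have := hf.add hτ (hf'.const_mul (-1))
  convert this using 1
  ext q
  simp [sub_eq_add_neg]

theorem indicator_accumulate (hτ : Measurable τ) {s : ℕ → Set (S × Ω)}
    (hd : Pairwise (Function.onFun Disjoint s))
    (h : ∀ n, IsSimpleLimit P c τ F ((s n).indicator fun _ => 1)) (n : ℕ) :
    IsSimpleLimit P c τ F ((Set.accumulate s n).indicator fun _ => 1) := by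
  induction n with
  | zero => simpa [Set.accumulate_zero_nat] using h 0
  | succ n ih =>
    rw [Set.accumulate_succ, Set.indicator_union_of_disjoint]
    · exact ih.add hτ (h (n + 1))
    · exact Set.disjoint_accumulate hd (Nat.lt_succ_self n)

theorem indicator_iUnion (hτ : Measurable τ) {s : ℕ → Set (S × Ω)}
    (hs : ∀ n, MeasurableSet (s n)) (hd : Pairwise (Function.onFun Disjoint s))
    (hfin : (c.prod P) (⋃ n, s n) < ∞)
    (h : ∀ n, IsSimpleLimit P c τ F ((s n).indicator fun _ => 1)) :
    IsSimpleLimit P c τ F ((⋃ n, s n).indicator fun _ => 1) := by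
  rw [← Set.iUnion_accumulate] at hfin ⊢
  exact indicator_iUnion_of_monotone hτ
    (fun n => MeasurableSet.biUnion (Set.to_countable _) fun i _ => hs i)
    Set.monotone_accumulate hfin (indicator_accumulate hτ hd h)

theorem indicator_box (hτ : Measurable τ) {a b : ℝ} {A : Set S} {D : Set Ω}
    (hA : MeasurableSet A) (hc : c A < ∞) (hD : MeasurableSet[F a] D) :
    IsSimpleLimit P c τ F (((A ∩ {z | a < τ z ∧ τ z ≤ b}) ×ˢ D).indicator fun _ => 1) := by
  let e : Elementary c τ F :=
    { a := a, b := b, A := A, Y := D.indicator fun _ => 1, measurableSet_A := hA, finite_A := hc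
      measurable_Y := measurable_const.indicator hD
      bounded_Y := ⟨1, fun ω => by by_cases h : ω ∈ D <;> simp [h]⟩ }
  convert of_simpleFun (P := P) hτ [e] using 1
  ext q
  have hr : e.region = A ∩ {z | a < τ z ∧ τ z ≤ b} := rfl
  by_cases h1 : q.1 ∈ e.region <;> by_cases h2 : q.2 ∈ D <;>
    simp [simpleFun, Set.mem_prod, h1, h2, ← hr, e]

/-- Predictable boxes are bounded in time; exhausting time by the intervals `(-n, n]` removes the
bound. -/
theorem indicator_prod_univ (hτ : Measurable τ) {A : Set S} (hA : MeasurableSet A)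
    (hc : c A < ∞) : IsSimpleLimit P c τ F ((A ×ˢ (Set.univ : Set Ω)).indicator fun _ => 1) := by
  have h := prod_univ_eq_iUnion_time_slab (Ω := Ω) A τ
  have hfin : (c.prod P) (A ×ˢ (Set.univ : Set Ω)) < ∞ := by simpa [Measure.prod_prod] using hc
  rw [h] at hfin ⊢
  refine indicator_iUnion_of_monotone hτ (fun n => ?_) ?_ hfin
    fun n => indicator_box hτ hA hc MeasurableSet.univ
  · exact (hA.inter ((measurableSet_lt measurable_const hτ).inter
      (measurableSet_le hτ measurable_const))).prod MeasurableSet.univ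
  · intro m n hmn
    have hmn' : (m : ℝ) ≤ n := by exact_mod_cast hmn
    refine Set.prod_mono (Set.inter_subset_inter_right A fun z hz => ?_) subset_rfl
    exact ⟨(neg_le_neg hmn').trans_lt hz.1, hz.2.trans hmn'⟩

end IsSimpleLimit

theorem isPiSystem_predictable (τ : S → ℝ) (F : Filtration ℝ ‹MeasurableSpace Ω›) :
    IsPiSystem {B : Set (S × Ω) | ∃ (a b : ℝ) (A : Set S) (D : Set Ω), MeasurableSet A ∧
      MeasurableSet[F a] D ∧ B = (A ∩ {z | a < τ z ∧ τ z ≤ b}) ×ˢ D} := by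
  rintro _ ⟨a, b, A, D, hA, hD, rfl⟩ _ ⟨a', b', A', D', hA', hD', rfl⟩ -
  -- The intersected interval starts at `max a a'`, and by then both events are known.
  refine ⟨max a a', min b b', A ∩ A', D ∩ D', hA.inter hA',
    (F.mono (le_max_left a a') _ hD).inter (F.mono (le_max_right a a') _ hD'), ?_⟩
  ext q
  simp only [Set.mem_inter_iff, Set.mem_prod, Set.mem_ofPred_eq, max_lt_iff, le_min_iff]
  tauto

theorem predictableSigma_le (hτ : Measurable τ) (F : Filtration ℝ ‹MeasurableSpace Ω›) :
    predictableSigma τ F ≤ Prod.instMeasurableSpace := by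
  refine MeasurableSpace.generateFrom_le ?_
  rintro _ ⟨a, b, A, D, hA, hD, rfl⟩
  exact (hA.inter ((measurableSet_lt measurable_const hτ).inter
    (measurableSet_le hτ measurable_const))).prod (F.le a _ hD)

theorem measurableSet_predictable_prod_univ {A : Set S} (hA : MeasurableSet A) :
    MeasurableSet[predictableSigma τ F] (A ×ˢ (Set.univ : Set Ω)) := by
  have h := prod_univ_eq_iUnion_time_slab (Ω := Ω) A τ
  rw [h]
  exact MeasurableSet.iUnion fun n => MeasurableSpace.measurableSet_generateFrom
    ⟨-(n : ℝ), n, A, Set.univ, hA, MeasurableSet.univ, rfl⟩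

theorem measurable_predictable_fst {f : S → ℝ} (hf : Measurable f) :
    Measurable[predictableSigma τ F] fun q : S × Ω => f q.1 := by
  intro s hs
  have h : (fun q : S × Ω => f q.1) ⁻¹' s = (f ⁻¹' s) ×ˢ (Set.univ : Set Ω) := by
    ext q; simp
  rw [h]
  exact measurableSet_predictable_prod_univ (hf hs)

/-- A time-preserving map pulls boxes back to boxes. This lifts the predictability of `σ` from `ℝ^d`
to `𝒳 × ℝ^d`. -/
theorem measurable_predictable_comp {S' : Type*} [MeasurableSpace S'] {τ' : S' → ℝ} {π : S → S'}
    (hπ : Measurable π) (h : ∀ z, τ' (π z) = τ z) :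
    Measurable[predictableSigma τ F, predictableSigma τ' F]
      fun q : S × Ω => (π q.1, q.2) := by
  refine @measurable_generateFrom _ _ (predictableSigma τ F) _ _ ?_
  rintro _ ⟨a, b, A, D, hA, hD, rfl⟩
  refine MeasurableSpace.measurableSet_generateFrom ⟨a, b, π ⁻¹' A, D, hπ hA, hD, ?_⟩
  ext q
  simp [h]

/-- A π-λ argument. Localizing to `R ×ˢ univ`, of finite measure, keeps complements and unions
within `L²`. -/
theorem IsSimpleLimit.indicator_inter [IsProbabilityMeasure P] (hτ : Measurable τ)
    {B : Set (S × Ω)} (hB : MeasurableSet[predictableSigma τ F] B) {R : Set S}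
    (hR : MeasurableSet R) (hc : c R < ∞) :
    IsSimpleLimit P c τ F ((B ∩ R ×ˢ (Set.univ : Set Ω)).indicator fun _ => 1) := by
  have hRu : MeasurableSet (R ×ˢ (Set.univ : Set Ω)) := hR.prod MeasurableSet.univ
  have hfin : (c.prod P) (R ×ˢ (Set.univ : Set Ω)) < ∞ := by simpa [Measure.prod_prod] using hc
  induction B, hB using MeasurableSpace.induction_on_inter rfl (isPiSystem_predictable τ F) with
  | empty =>
    convert IsSimpleLimit.of_simpleFun (P := P) hτ ([] : List (Elementary c τ F)) using 1
    ext q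
    simp [simpleFun]
  | basic t ht =>
    obtain ⟨a, b, A, D, hA, hD, rfl⟩ := ht
    convert indicator_box (P := P) (b := b) hτ (hA.inter hR)
      ((measure_mono Set.inter_subset_right).trans_lt hc) hD using 2
    ext q
    simp only [Set.mem_inter_iff, Set.mem_prod, Set.mem_ofPred_eq, Set.mem_univ]
    tauto
  | compl t ht ih =>
    have h := (indicator_prod_univ hτ hR hc).sub_indicator hτ ih
    rwa [← Set.indicator_sdiff Set.inter_subset_right, Set.sdiff_inter_self_eq_sdiff,
      Set.sdiff_eq, Set.inter_comm] at h
  | iUnion f hd hf ih =>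
    rw [Set.iUnion_inter]
    refine indicator_iUnion hτ (fun n => (predictableSigma_le hτ F _ (hf n)).inter hRu)
      (fun m n hmn => (hd hmn).mono Set.inter_subset_left Set.inter_subset_left) ?_ ih
    rw [← Set.iUnion_inter]
    exact (measure_mono Set.inter_subset_right).trans_lt hfin

theorem IsSimpleLimit.indicator [IsProbabilityMeasure P] [SigmaFinite c] (hτ : Measurable τ)
    {B : Set (S × Ω)} (hB : MeasurableSet[predictableSigma τ F] B) (hfin : (c.prod P) B < ∞) :
    IsSimpleLimit P c τ F (B.indicator fun _ => 1) := by
  have h : B = ⋃ n, B ∩ spanningSets c n ×ˢ (Set.univ : Set Ω) := by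
    rw [← Set.inter_iUnion, ← Set.iUnion_prod_const, iUnion_spanningSets, Set.univ_prod_univ,
      Set.inter_univ]
  have hm := predictableSigma_le hτ F _ hB
  have hm' := measurableSet_spanningSets c
  have hf' := measure_spanningSets_lt_top c
  rw [h] at hfin ⊢
  exact indicator_iUnion_of_monotone hτ (fun n => hm.inter ((hm' n).prod MeasurableSet.univ))
    (fun m n hmn => Set.inter_subset_inter_right _
      (Set.prod_mono (monotone_spanningSets c hmn) subset_rfl)) hfin
    fun n => indicator_inter hτ hB (hm' n) (hf' n)

/-- The usual approximation by step functions is carried out for the measure trimmed to the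
predictable σ-algebra, which forces the approximating sets to be predictable; trimming does not
change `L²` norms. -/
theorem IsSimpleLimit.of_predictable [IsProbabilityMeasure P] [SigmaFinite c] (hτ : Measurable τ)
    {f : S × Ω → ℝ} (hf : Measurable[predictableSigma τ F] f) (hf2 : MemLp f 2 (c.prod P)) :
    IsSimpleLimit P c τ F f := by
  have hle := predictableSigma_le hτ F
  have hfs : StronglyMeasurable[predictableSigma τ F] f :=
    hf.stronglyMeasurable
  have hf2' : @MemLp _ _ (predictableSigma τ F) _ _ f 2 ((c.prod P).trim hle) :=
    ⟨@StronglyMeasurable.aestronglyMeasurable _ _ _ (predictableSigma τ F)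
      (predictableSigma τ F) _ _ hfs, by rw [eLpNorm_trim hle hfs]; exact hf2.2⟩
  refine of_forall_exists hτ hf2.1 fun ε hε => ?_
  have key : ∃ g, eLpNorm (f - g) 2 ((c.prod P).trim hle) ≤ ε ∧
      (StronglyMeasurable[predictableSigma τ F] g ∧ IsSimpleLimit P c τ F g) := by
    refine @MemLp.induction_dense _ _ (predictableSigma τ F) _ 2
      ((c.prod P).trim hle) (by norm_num)
      (fun g => StronglyMeasurable[predictableSigma τ F] g ∧ IsSimpleLimit P c τ F g) ?_ ?_ ?_ f
      hf2' ε hε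
    · intro k s hs hsf δ hδ
      rw [trim_measurableSet_eq hle hs] at hsf
      refine ⟨s.indicator fun _ => k, by simp, stronglyMeasurable_const.indicator hs, ?_⟩
      convert (IsSimpleLimit.indicator hτ hs hsf).const_mul k using 1
      ext q
      by_cases h : q ∈ s <;> simp [h]
    · exact fun g g' h h' => ⟨h.1.add h'.1, h.2.add hτ h'.2⟩
    · exact fun g h => @StronglyMeasurable.aestronglyMeasurable _ _ _ (predictableSigma τ F)
        (predictableSigma τ F) _ _ h.1
  obtain ⟨g, hg, hgm, hgl⟩ := key
  refine ⟨g, hgl, ?_⟩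
  rw [← eLpNorm_neg, neg_sub]
  rwa [eLpNorm_trim hle (hfs.sub hgm)] at hg

end Density

/-! ### Isometry, mean and existence of the Walsh integral -/

section WalshIntegral

variable {Ω S : Type*} [MeasurableSpace Ω] [MeasurableSpace S] {P : Measure Ω}
  [IsProbabilityMeasure P] {c : Measure S}
  {W : Set S → Ω → ℝ} {τ : S → ℝ} {F : Filtration ℝ ‹MeasurableSpace Ω›}

theorem inner_toLp_eq_integral {α : Type*} {m : MeasurableSpace α} {μ : Measure α} {f g : α → ℝ}
    (hf : MemLp f 2 μ) (hg : MemLp g 2 μ) :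
    inner ℝ (hf.toLp f) (hg.toLp g) = ∫ x, f x * g x ∂μ := by
  rw [L2.inner_def]
  refine integral_congr_ae ?_
  filter_upwards [hf.coeFn_toLp, hg.coeFn_toLp] with x h1 h2
  rw [h1, h2]
  simp [mul_comm]

theorem tendsto_toLp_of_eLpNorm {α : Type*} {m : MeasurableSpace α} {μ : Measure α}
    {f : ℕ → α → ℝ} (hf : ∀ n, MemLp (f n) 2 μ) {g : α → ℝ} (hg : MemLp g 2 μ)
    (h : Tendsto (fun n => eLpNorm (fun x => f n x - g x) 2 μ) atTop (𝓝 0)) :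
    Tendsto (fun n => (hf n).toLp (f n)) atTop (𝓝 (hg.toLp g)) :=
  (Lp.tendsto_Lp_iff_tendsto_eLpNorm'' f hf g hg).2 h

theorem IsWalshIntegral.integral_mul [SFinite c] (hτ : Measurable τ)
    (hW : IsGaussianWhiteNoise P c W) (hF : IsNoiseFiltration P c W τ F) {Φ Ψ : S × Ω → ℝ}
    {I J : Ω → ℝ} (hΦ : MemLp Φ 2 (c.prod P)) (hΨ : MemLp Ψ 2 (c.prod P))
    (hI : IsWalshIntegral P c τ F W Φ I) (hJ : IsWalshIntegral P c τ F W Ψ J) :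
    ∫ ω, I ω * J ω ∂P = ∫ q, Φ q * Ψ q ∂(c.prod P) := by
  obtain ⟨hI2, φ, hφ, hφI⟩ := hI
  obtain ⟨hJ2, ψ, hψ, hψJ⟩ := hJ
  have t1 := (tendsto_toLp_of_eLpNorm (fun n => memLp_simpleIntegral hτ hW (φ n)) hI2 hφI).inner
    (𝕜 := ℝ) (tendsto_toLp_of_eLpNorm (fun n => memLp_simpleIntegral hτ hW (ψ n)) hJ2 hψJ)
  have t2 := (tendsto_toLp_of_eLpNorm (fun n => memLp_simpleFun hτ (φ n)) hΦ hφ).inner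
    (𝕜 := ℝ) (tendsto_toLp_of_eLpNorm (fun n => memLp_simpleFun hτ (ψ n)) hΨ hψ)
  simp_rw [inner_toLp_eq_integral] at t1 t2
  simp_rw [integral_simpleIntegral_mul hτ hW hF] at t1
  exact tendsto_nhds_unique t1 t2

theorem IsWalshIntegral.integral_eq_zero (hτ : Measurable τ)
    (hW : IsGaussianWhiteNoise P c W) (hF : IsNoiseFiltration P c W τ F) {Φ : S × Ω → ℝ}
    {I : Ω → ℝ} (hI : IsWalshIntegral P c τ F W Φ I) : ∫ ω, I ω ∂P = 0 := by
  obtain ⟨hI2, φ, hφ, hφI⟩ := hI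
  -- The mean is the inner product with the constant `1`, hence `L²`-continuous.
  have t1 := (tendsto_toLp_of_eLpNorm (fun n => memLp_simpleIntegral hτ hW (φ n)) hI2 hφI).inner
    (𝕜 := ℝ) (tendsto_const_nhds (x := (memLp_const (1 : ℝ) (p := 2) (μ := P)).toLp _))
  simp_rw [inner_toLp_eq_integral, mul_one, integral_simpleIntegral hτ hW hF] at t1
  exact tendsto_nhds_unique t1 tendsto_const_nhds

theorem exists_isWalshIntegral [SigmaFinite c] (hτ : Measurable τ)
    (hW : IsGaussianWhiteNoise P c W) (hF : IsNoiseFiltration P c W τ F) {Φ : S × Ω → ℝ}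
    (hΦ : Measurable[predictableSigma τ F] Φ) (hΦ2 : MemLp Φ 2 (c.prod P)) :
    ∃ I, IsWalshIntegral P c τ F W Φ I := by
  have hlim := IsSimpleLimit.of_predictable hτ hΦ hΦ2
  choose φ hφ using fun n : ℕ => hlim.2 ((n : ℝ≥0∞) + 1)⁻¹ (by simp)
  have hφt : Tendsto (fun n => eLpNorm (fun q => simpleFun (φ n) q - Φ q) 2 (c.prod P)) atTop
      (𝓝 0) := by
    refine tendsto_of_tendsto_of_tendsto_of_le_of_le tendsto_const_nhds ?_ (fun _ => zero_le) hφ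
    have := (tendsto_add_atTop_iff_nat 1).2 ENNReal.tendsto_inv_nat_nhds_zero
    simpa using this
  set y := fun n => (memLp_simpleFun (P := P) hτ (φ n)).toLp (simpleFun (φ n)) with hy
  set x := fun n => (memLp_simpleIntegral hτ hW (φ n)).toLp (simpleIntegral W (φ n)) with hx
  have hyc : CauchySeq y :=
    (tendsto_toLp_of_eLpNorm (fun n => memLp_simpleFun hτ (φ n)) hΦ2 hφt).cauchySeq
  have hin : ∀ m n, inner ℝ (x m) (x n) = inner ℝ (y m) (y n) := fun m n => by
    simp only [hx, hy, inner_toLp_eq_integral, integral_simpleIntegral_mul hτ hW hF]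
  -- Equal inner products give equal mutual distances, so the Cauchy property passes from the
  -- integrands to their integrals.
  have hdist : ∀ m n, dist (x m) (x n) = dist (y m) (y n) := fun m n => by
    rw [dist_eq_norm, dist_eq_norm, ← sq_eq_sq₀ (norm_nonneg _) (norm_nonneg _),
      norm_sub_sq_real, norm_sub_sq_real, hin, ← real_inner_self_eq_norm_sq,
      ← real_inner_self_eq_norm_sq, ← real_inner_self_eq_norm_sq, ← real_inner_self_eq_norm_sq,
      hin, hin]
  have hxc : CauchySeq x := by
    rw [Metric.cauchySeq_iff] at hyc ⊢
    simpa only [hdist] using hyc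
  obtain ⟨I, hI⟩ := cauchySeq_tendsto_of_complete hxc
  refine ⟨I, Lp.memLp I, φ, hφt, ?_⟩
  refine (Lp.tendsto_Lp_iff_tendsto_eLpNorm'' (fun n => simpleIntegral W (φ n))
    (fun n => memLp_simpleIntegral hτ hW (φ n)) I (Lp.memLp I)).1 ?_
  rwa [Lp.toLp_coeFn]

end WalshIntegral

/-! ### Translation and modulation under the `L²`-Fourier transform -/

section Translation

variable {E : Type*} [NormedAddCommGroup E] [InnerProductSpace ℝ E] [FiniteDimensional ℝ E]
  [MeasurableSpace E] [BorelSpace E]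

/-- The character `u ↦ e^{2πi h·u}` as an element of `L^∞`. -/
noncomputable def charLp (h : E) : Lp ℂ ∞ (volume : Measure E) :=
  MemLp.toLp (fun u : E => ((Real.fourierChar (inner ℝ h u) : Circle) : ℂ))
    (memLp_top_of_bound (by fun_prop) 1 (ae_of_all _ fun _ => (Circle.norm_coe _).le))

theorem coeFn_charLp (h : E) :
    charLp h =ᵐ[volume] fun u : E => ((Real.fourierChar (inner ℝ h u) : Circle) : ℂ) :=
  MemLp.coeFn_toLp _

/-- Multiplication by the character `u ↦ e^{2πi h·u}` on `L²`. -/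
noncomputable def modulationLp (h : E) :
    Lp ℂ 2 (volume : Measure E) →L[ℂ] Lp ℂ 2 (volume : Measure E) :=
  (ContinuousLinearMap.mul ℂ ℂ).holderL volume ∞ 2 2 (charLp h)

theorem coeFn_modulationLp (h : E) (f : Lp ℂ 2 (volume : Measure E)) :
    modulationLp h f =ᵐ[volume]
      fun u : E => ((Real.fourierChar (inner ℝ h u) : Circle) : ℂ) * f u := by
  have h1 := (ContinuousLinearMap.mul ℂ ℂ).coeFn_holder (r := 2) (charLp h) f
  have h2 : modulationLp h f = (ContinuousLinearMap.mul ℂ ℂ).holder 2 (charLp h) f := rfl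
  rw [h2]
  filter_upwards [h1, coeFn_charLp h] with u h1 h2
  rw [h1, h2]
  rfl

/-- Translation by `h` on `L²`. -/
noncomputable def translationLp (h : E) (f : Lp ℂ 2 (volume : Measure E)) :
    Lp ℂ 2 (volume : Measure E) :=
  Lp.compMeasurePreserving (fun s => s + h) (measurePreserving_add_right volume h) f

theorem coeFn_translationLp (h : E) (f : Lp ℂ 2 (volume : Measure E)) :
    translationLp h f =ᵐ[volume] fun s => f (s + h) :=
  Lp.coeFn_compMeasurePreserving f (measurePreserving_add_right volume h)

/-- Both sides are continuous in `f`, and on the dense Schwartz functions this is a change of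
variables in the Fourier integral. -/
theorem fourier_translationLp (h : E) (f : Lp ℂ 2 (volume : Measure E)) :
    𝓕 (translationLp h f) = modulationLp h (𝓕 f) := by
  refine DenseRange.induction_on (p := fun f => 𝓕 (translationLp h f) = modulationLp h (𝓕 f))
    (SchwartzMap.denseRange_toLpCLM (p := 2) ENNReal.ofNat_ne_top) f ?_ ?_
  · refine isClosed_eq ?_ ?_
    · exact (Lp.fourierTransformₗᵢ E ℂ).continuous.comp
        (Lp.isometry_compMeasurePreserving (measurePreserving_add_right volume h)).continuous
    · exact (modulationLp h).continuous.comp (Lp.fourierTransformₗᵢ E ℂ).continuous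
  · intro f
    rw [SchwartzMap.toLpCLM_apply, SchwartzMap.toLp_fourier_eq]
    have h1 : translationLp h (f.toLp 2) = (SchwartzMap.compSubConstCLM ℂ (-h) f).toLp 2 := by
      refine Lp.ext ?_
      have h2 := (measurePreserving_add_right volume h).quasiMeasurePreserving.ae_eq_comp
        (f.coeFn_toLp 2)
      filter_upwards [coeFn_translationLp h (f.toLp 2), h2,
        (SchwartzMap.compSubConstCLM ℂ (-h) f).coeFn_toLp 2] with x a b c
      rw [a, c]
      simpa using b
    rw [h1, SchwartzMap.toLp_fourier_eq]
    refine Lp.ext ?_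
    filter_upwards [coeFn_modulationLp h ((𝓕 f).toLp 2), (𝓕 f).coeFn_toLp 2,
      (𝓕 (SchwartzMap.compSubConstCLM ℂ (-h) f)).coeFn_toLp 2] with u a b c
    rw [a, b, c, SchwartzMap.fourier_coe, SchwartzMap.fourier_coe]
    have h2 : (SchwartzMap.compSubConstCLM ℂ (-h) f : E → ℂ) = (f : E → ℂ) ∘ fun v => v + h := by
      ext x
      simp
    rw [h2]
    exact congrFun (VectorFourier.fourierIntegral_comp_add_right Real.fourierChar volume
      (innerₗ E) (f : E → ℂ) h) u

/-- The Wiener–Khinchin identity for `L²` functions. -/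
theorem integral_conj_mul_translation (h : E) (f : Lp ℂ 2 (volume : Measure E)) :
    ∫ s, starRingEnd ℂ (f s) * f (s + h) =
      ∫ u, ((Real.fourierChar (inner ℝ h u) : Circle) : ℂ) * ((‖(𝓕 f) u‖ ^ 2 : ℝ) : ℂ) := by
  -- Plancherel for `f` and its translate.
  have h1 := Lp.inner_fourier_eq f (translationLp h f)
  rw [fourier_translationLp, L2.inner_def, L2.inner_def] at h1
  calc ∫ s, starRingEnd ℂ (f s) * f (s + h) = ∫ s, inner ℂ (f s) ((translationLp h f) s) := by
        refine integral_congr_ae ?_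
        filter_upwards [coeFn_translationLp h f] with s hs
        rw [hs, RCLike.inner_apply, mul_comm]
    _ = _ := h1.symm
    _ = _ := by
        refine integral_congr_ae ?_
        filter_upwards [coeFn_modulationLp h (𝓕 f)] with u hu
        rw [hu, RCLike.inner_apply, mul_assoc, Complex.mul_conj, Complex.normSq_eq_norm_sq]

end Translation

/-! ### Jointly measurable representatives of `L²`-valued maps -/

section MeasurableVersion

variable {𝒳 E : Type*} [MeasurableSpace 𝒳] [MeasurableSpace E]

/-- `G x` is approximated within `2⁻ⁿ` by the first suitable member of a dense sequence. That index
depends measurably on `x` and takes countably many values, so the approximants are jointly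
measurable. Their squared errors have summable integrals, which forces convergence almost everywhere
for each `x`. -/
theorem exists_measurable_version {μ : Measure E} [SFinite μ]
    [MeasurableSpace.CountablyGenerated E] (G : 𝒳 → Lp ℂ 2 μ)
    (hG : ∀ v, Measurable fun x => edist (G x) v) :
    ∃ w : 𝒳 → E → ℂ, Measurable (Function.uncurry w) ∧ ∀ x, w x =ᵐ[μ] G x := by
  classical
  have : Fact ((2 : ℝ≥0∞) ≠ ∞) := ⟨by norm_num⟩
  let v : ℕ → Lp ℂ 2 μ := TopologicalSpace.denseSeq (Lp ℂ 2 μ)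
  have hv : ∀ n x, ∃ k, edist (G x) (v k) < (2⁻¹ : ℝ≥0∞) ^ n := fun n x => by
    obtain ⟨_, ⟨k, rfl⟩, hk⟩ := EMetric.mem_closure_iff.1
      ((TopologicalSpace.denseRange_denseSeq (Lp ℂ 2 μ)) (G x)) ((2⁻¹ : ℝ≥0∞) ^ n)
      (pos_iff_ne_zero.2 (pow_ne_zero _ (by simp)))
    exact ⟨k, hk⟩
  let k : ℕ → 𝒳 → ℕ := fun n x => Nat.find (hv n x)
  have hk : ∀ n, Measurable (k n) := fun n =>
    measurable_find (hv n) fun j => measurableSet_lt (hG (v j)) measurable_const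
  let a : ℕ → 𝒳 × E → ℂ := fun n z => v (k n z.1) z.2
  have ha : ∀ n, Measurable (a n) := fun n => by
    have h1 : Measurable fun z : ℕ × E => v z.1 z.2 :=
      measurable_from_prod_countable_right fun j => (Lp.stronglyMeasurable (v j)).measurable
    exact h1.comp (((hk n).comp measurable_fst).prodMk measurable_snd)
  -- Where the sequence diverges `limUnder` takes a default value; for each `x` this concerns a null
  -- set of `u` only.
  refine ⟨fun x u => limUnder atTop fun n => a n (x, u), ?_, fun x => ?_⟩
  · exact (StronglyMeasurable.limUnder (l := atTop)
      fun n => (ha n).stronglyMeasurable).measurable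
  have hm : ∀ n, AEMeasurable (fun u => ‖a n (x, u) - G x u‖ₑ ^ 2) μ := fun n =>
    ((((ha n).comp measurable_prodMk_left).sub
      (Lp.stronglyMeasurable (G x)).measurable).enorm.pow_const 2).aemeasurable
  have hle : ∀ n, ∫⁻ u, ‖a n (x, u) - G x u‖ₑ ^ 2 ∂μ ≤ (2⁻¹ : ℝ≥0∞) ^ n := fun n => by
    have h1 : edist (G x) (v (k n x)) < (2⁻¹ : ℝ≥0∞) ^ n := Nat.find_spec (hv n x)
    rw [edist_comm, Lp.edist_def] at h1
    have h2 := eLpNorm_nnreal_pow_eq_lintegral (f := ⇑(v (k n x)) - ⇑(G x)) (μ := μ)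
      (p := 2) (by norm_num)
    simp only [NNReal.coe_ofNat, ENNReal.coe_ofNat, Pi.sub_apply, ENNReal.rpow_ofNat] at h2
    change ∫⁻ u, ‖v (k n x) u - G x u‖ₑ ^ 2 ∂μ ≤ _
    rw [← h2]
    calc eLpNorm (⇑(v (k n x)) - ⇑(G x)) 2 μ ^ 2 ≤ ((2⁻¹ : ℝ≥0∞) ^ n) ^ 2 := by gcongr
      _ ≤ (2⁻¹ : ℝ≥0∞) ^ n := by
        rw [← pow_mul]
        exact pow_le_pow_of_le_one zero_le (by simp) (by omega)
  have hsum : ∫⁻ u, ∑' n, ‖a n (x, u) - G x u‖ₑ ^ 2 ∂μ ≠ ∞ := by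
    rw [lintegral_tsum hm]
    refine ((ENNReal.tsum_le_tsum hle).trans_lt ?_).ne
    rw [ENNReal.tsum_geometric]
    simp
  filter_upwards [ae_lt_top' (AEMeasurable.tsum hm) hsum] with u hu
  refine Tendsto.limUnder_eq ?_
  have h0 := ENNReal.tendsto_atTop_zero_of_tsum_ne_top hu.ne
  rw [tendsto_iff_edist_tendsto_0]
  have h1 := h0.ennrpow_const (1 / 2)
  rw [ENNReal.zero_rpow_of_pos (by norm_num)] at h1
  refine h1.congr fun n => ?_
  rw [edist_eq_enorm_sub, ← ENNReal.rpow_natCast, ← ENNReal.rpow_mul]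
  norm_num

end MeasurableVersion

/-! ### The Fourier transform of the kernel -/

section FourierVersion

variable {𝒳 : Type*} [MeasurableSpace 𝒳] {d : ℕ}

theorem exists_isFourierVersion (p : Measure 𝒳) (g : 𝒳 → EuclideanSpace ℝ (Fin d) → ℝ)
    (hg : Measurable (Function.uncurry g))
    (hg2 : ∀ᵐ x ∂p, MemLp (fun s => (g x s : ℂ)) 2 volume) :
    ∃ ghat, IsFourierVersion p g ghat := by
  classical
  let M : Set 𝒳 := {x | MemLp (fun s => (g x s : ℂ)) 2 volume}
  have hgx : ∀ x, Measurable fun s => (g x s : ℂ) := fun x =>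
    Complex.measurable_ofReal.comp (hg.comp measurable_prodMk_left)
  have hnorm : ∀ v : EuclideanSpace ℝ (Fin d) → ℂ, Measurable v →
      Measurable fun x => eLpNorm (fun s => (g x s : ℂ) - v s) 2 volume := fun v hv => by
    simp_rw [eLpNorm_eq_lintegral_rpow_enorm_toReal (p := 2) (by norm_num) (by norm_num)]
    refine Measurable.pow_const (Measurable.lintegral_prod_right' (f := fun z : 𝒳 × _ =>
      ‖(g z.1 z.2 : ℂ) - v z.2‖ₑ ^ (2 : ℝ≥0∞).toReal) ?_) _
    exact ((Complex.measurable_ofReal.comp hg).sub (hv.comp measurable_snd)).enorm.pow_const _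
  have hM : MeasurableSet M := by
    have h1 : M = {x | eLpNorm (fun s => (g x s : ℂ) - 0) 2 volume < ∞} := by
      ext x
      simp only [M, sub_zero]
      exact ⟨fun h => h.2, fun h => ⟨(hgx x).aestronglyMeasurable, h⟩⟩
    rw [h1]
    exact measurableSet_lt (hnorm _ measurable_const) measurable_const
  let G : 𝒳 → Lp ℂ 2 (volume : Measure (EuclideanSpace ℝ (Fin d))) := fun x =>
    if h : MemLp (fun s => (g x s : ℂ)) 2 volume then h.toLp _ else 0
  have hG : ∀ v, Measurable fun x => edist (G x) v := fun v => by
    have h1 : (fun x => edist (G x) v) = M.piecewise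
        (fun x => eLpNorm (fun s => (g x s : ℂ) - v s) 2 volume) (fun _ => edist 0 v) := by
      ext x
      by_cases h : x ∈ M
      · have h' : MemLp (fun s => (g x s : ℂ)) 2 volume := h
        rw [Set.piecewise_eq_of_mem _ _ _ h]
        simp only [G, dif_pos h']
        rw [Lp.edist_def]
        refine eLpNorm_congr_ae ?_
        filter_upwards [h'.coeFn_toLp] with s hs
        simp [hs]
      · have h' : ¬ MemLp (fun s => (g x s : ℂ)) 2 volume := h
        rw [Set.piecewise_eq_of_notMem _ _ _ h]
        simp only [G, dif_neg h']
    rw [h1]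
    exact (hnorm _ (Lp.stronglyMeasurable v).measurable).piecewise hM measurable_const
  obtain ⟨w, hw, hwG⟩ := exists_measurable_version (fun x => 𝓕 (G x)) fun (v : Lp ℂ 2 volume) => by
    -- The transform is an isometry, so measurability of distances for `G` transfers to its
    -- transform.
    have h1 : ∀ x, edist (𝓕 (G x)) v = edist (G x) (𝓕⁻ v : Lp ℂ 2 volume) := fun x => by
      have h2 : 𝓕 (𝓕⁻ v : Lp ℂ 2 volume) = v := (Lp.fourierTransformₗᵢ _ ℂ).apply_symm_apply v
      conv_lhs => rw [← h2]
      exact (Lp.fourierTransformₗᵢ (EuclideanSpace ℝ (Fin d)) ℂ).isometry.edist_eq _ _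
    simp_rw [h1]
    exact hG _
  refine ⟨fun x u => (((2 * Real.pi) ^ (-(d : ℝ) / 2) : ℝ) : ℂ) * w x ((2 * Real.pi)⁻¹ • u),
    ?_, ?_⟩
  · exact measurable_const.mul
      (hw.comp (measurable_fst.prodMk (measurable_snd.const_smul (2 * Real.pi)⁻¹)))
  · filter_upwards [hg2] with x hx
    refine ⟨hx, ?_⟩
    have hGx : G x = hx.toLp _ := dif_pos hx
    -- Dilations preserve null sets, so the almost everywhere identity survives rescaling.
    have h1 := (Measure.quasiMeasurePreserving_smul
      (volume : Measure (EuclideanSpace ℝ (Fin d))) (r := (2 * Real.pi)⁻¹)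
      (by positivity)).ae_eq_comp (hwG x)
    filter_upwards [h1] with u hu
    rw [← hGx]
    exact congrArg _ hu

theorem IsL2FourierTransform.norm_sq {f : EuclideanSpace ℝ (Fin d) → ℝ}
    {fhat : EuclideanSpace ℝ (Fin d) → ℂ} (hf : MemLp (fun s => (f s : ℂ)) 2 volume)
    (h : IsL2FourierTransform f fhat) :
    (fun u => ‖fhat u‖ ^ 2) =ᵐ[volume] fun u => (2 * Real.pi) ^ (-(d : ℝ)) *
      ‖(𝓕 (hf.toLp _) : Lp ℂ 2 volume) ((2 * Real.pi)⁻¹ • u)‖ ^ 2 := by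
  obtain ⟨hf', h⟩ := h
  filter_upwards [h] with u hu
  rw [hu, norm_mul, mul_pow, Complex.norm_real, Real.norm_of_nonneg (by positivity),
    ← Real.rpow_natCast, ← Real.rpow_mul (by positivity)]
  congr 2
  push_cast
  ring

theorem IsL2FourierTransform.integrable_norm_sq {f : EuclideanSpace ℝ (Fin d) → ℝ}
    {fhat : EuclideanSpace ℝ (Fin d) → ℂ} (h : IsL2FourierTransform f fhat) :
    Integrable fun u => ‖fhat u‖ ^ 2 := by
  obtain ⟨hf, -⟩ := id h
  refine (integrable_congr (h.norm_sq hf)).2 (Integrable.const_mul ?_ _)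
  refine (integrable_comp_smul_iff volume (fun u => ‖(𝓕 (hf.toLp _) : Lp ℂ 2 volume) u‖ ^ 2)
    (by positivity)).2 ?_
  exact (Lp.memLp _).integrable_norm_pow (by norm_num)

/-- The Wiener–Khinchin identity in the unitary normalization: under `u = 2π v` the Jacobian
`(2π)^d` cancels the squared factor `(2π)^{-d}`, and the kernel `e^{2πi h·v}` becomes `e^{i h·u}`.
-/
theorem IsL2FourierTransform.integral_mul_translation {f : EuclideanSpace ℝ (Fin d) → ℝ}
    {fhat : EuclideanSpace ℝ (Fin d) → ℂ} (hfh : IsL2FourierTransform f fhat)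
    (h : EuclideanSpace ℝ (Fin d)) :
    ((∫ s, f s * f (s + h) : ℝ) : ℂ) =
      ∫ u, Complex.exp (Complex.I * (inner ℝ h u : ℝ)) * ((‖fhat u‖ ^ 2 : ℝ) : ℂ) := by
  obtain ⟨hf, -⟩ := id hfh
  have h1 := integral_conj_mul_translation h (hf.toLp _)
  have h2 : ∫ s, starRingEnd ℂ ((hf.toLp _ : Lp ℂ 2 volume) s) *
      (hf.toLp _ : Lp ℂ 2 volume) (s + h) = ((∫ s, f s * f (s + h) : ℝ) : ℂ) := by
    rw [← integral_complex_ofReal]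
    refine integral_congr_ae ?_
    have h3 := (measurePreserving_add_right volume h).quasiMeasurePreserving.ae_eq_comp
      hf.coeFn_toLp
    filter_upwards [hf.coeFn_toLp, h3] with s a b
    simp only [Function.comp_apply] at b
    rw [a, b]
    simp
  have hpi : 0 < 2 * Real.pi := by positivity
  rw [← h2, h1]
  have h4 := Measure.integral_comp_smul volume (fun v : EuclideanSpace ℝ (Fin d) =>
    ((Real.fourierChar (inner ℝ h v) : Circle) : ℂ) *
      ((‖(𝓕 (hf.toLp _) : Lp ℂ 2 volume) v‖ ^ 2 : ℝ) : ℂ)) (2 * Real.pi)⁻¹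
  have h5 : |(((2 * Real.pi)⁻¹ ^ d)⁻¹ : ℝ)| = (2 * Real.pi) ^ d := by
    rw [inv_pow, inv_inv, abs_of_pos (by positivity)]
  rw [finrank_euclideanSpace_fin, h5] at h4
  have h6 : ∫ u, Complex.exp (Complex.I * (inner ℝ h u : ℝ)) * ((‖fhat u‖ ^ 2 : ℝ) : ℂ) =
      ∫ u, ((2 * Real.pi) ^ (-(d : ℝ)) : ℝ) •
        (((Real.fourierChar (inner ℝ h ((2 * Real.pi)⁻¹ • u)) : Circle) : ℂ) *
        ((‖(𝓕 (hf.toLp _) : Lp ℂ 2 volume) ((2 * Real.pi)⁻¹ • u)‖ ^ 2 : ℝ) : ℂ)) := by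
    refine integral_congr_ae ?_
    filter_upwards [hfh.norm_sq hf] with u hu
    rw [hu, Real.fourierChar_apply, inner_smul_right, ← mul_assoc (2 * Real.pi),
      mul_inv_cancel₀ hpi.ne', one_mul, Complex.real_smul, mul_comm Complex.I]
    push_cast
    ring
  rw [h6, integral_smul, h4, smul_smul, Real.rpow_neg hpi.le, Real.rpow_natCast,
    inv_mul_cancel₀ (by positivity), one_smul]

end FourierVersion

/-! ### Uniqueness of spectral densities -/

section Uniqueness

variable {E : Type*} [NormedAddCommGroup E] [InnerProductSpace ℝ E] [FiniteDimensional ℝ E]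
  [MeasurableSpace E] [BorelSpace E]

theorem charFun_withDensity_ofReal {f : E → ℝ} (hf : Integrable f) (hf0 : 0 ≤ᵐ[volume] f) (h : E) :
    charFun (volume.withDensity fun u => ENNReal.ofReal (f u)) h =
      ∫ u, Complex.exp (Complex.I * (inner ℝ h u : ℝ)) * (f u : ℂ) := by
  rw [charFun_apply, integral_withDensity_eq_integral_toReal_smul₀
    hf.1.aemeasurable.ennreal_ofReal (ae_of_all _ fun _ => ENNReal.ofReal_lt_top)]
  refine integral_congr_ae ?_
  filter_upwards [hf0] with u hu
  rw [ENNReal.toReal_ofReal hu, Complex.real_smul, real_inner_comm, mul_comm, mul_comm Complex.I]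

/-- Nonnegative integrable functions are densities of finite measures, and these are determined by
their characteristic functions. -/
theorem ae_eq_of_fourier_eq {f f' : E → ℝ} (hf : Integrable f) (hf' : Integrable f')
    (hf0 : 0 ≤ᵐ[volume] f) (hf0' : 0 ≤ᵐ[volume] f')
    (h : ∀ h : E, ∫ u, Complex.exp (Complex.I * (inner ℝ h u : ℝ)) * (f u : ℂ) =
      ∫ u, Complex.exp (Complex.I * (inner ℝ h u : ℝ)) * (f' u : ℂ)) : f =ᵐ[volume] f' := by
  have := isFiniteMeasure_withDensity_ofReal hf.2
  have := isFiniteMeasure_withDensity_ofReal hf'.2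
  have h1 : (volume.withDensity fun u => ENNReal.ofReal (f u)) =
      volume.withDensity fun u => ENNReal.ofReal (f' u) := by
    refine Measure.ext_of_charFun (funext fun t => ?_)
    rw [charFun_withDensity_ofReal hf hf0, charFun_withDensity_ofReal hf' hf0', h]
  rw [withDensity_eq_iff_of_sigmaFinite hf.1.aemeasurable.ennreal_ofReal
    hf'.1.aemeasurable.ennreal_ofReal] at h1
  filter_upwards [h1, hf0, hf0'] with u a b c
  rwa [ENNReal.ofReal_eq_ofReal_iff b c] at a

end Uniqueness

/-! ### Integrating over the mixing variable -/

section SpectralFunction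

variable {𝒳 : Type*} [MeasurableSpace 𝒳] {d : ℕ} {p : Measure 𝒳}
  {g : 𝒳 → EuclideanSpace ℝ (Fin d) → ℝ} {ghat : 𝒳 → EuclideanSpace ℝ (Fin d) → ℂ}

theorem ae_memLp_of_memLp_uncurry [SFinite p] (hg : Measurable (Function.uncurry g))
    (hg2 : MemLp (Function.uncurry g) 2 (p.prod volume)) :
    ∀ᵐ x ∂p, MemLp (fun s => (g x s : ℂ)) 2 volume := by
  filter_upwards [hg2.integrable_sq.prod_right_ae] with x hx
  have h1 : Measurable (g x) := hg.comp measurable_prodMk_left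
  exact ((memLp_two_iff_integrable_sq h1.aestronglyMeasurable).2 hx).ofReal

theorem integrable_norm_sq_prod (hg2 : MemLp (Function.uncurry g) 2 (p.prod volume))
    (h : IsFourierVersion p g ghat) :
    Integrable (fun z : 𝒳 × EuclideanSpace ℝ (Fin d) => ‖ghat z.1 z.2‖ ^ 2)
      (p.prod volume) := by
  have hm : Measurable fun z : 𝒳 × EuclideanSpace ℝ (Fin d) => ‖ghat z.1 z.2‖ ^ 2 :=
    h.1.norm.pow_const 2
  rw [integrable_prod_iff hm.aestronglyMeasurable]
  refine ⟨h.2.mono fun x hx => hx.integrable_norm_sq, ?_⟩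
  refine (integrable_congr ?_).2 hg2.integrable_sq.integral_prod_left
  filter_upwards [h.2] with x hx
  -- Lag zero is Plancherel: `∫ |ghat(x, u)|² du = ∫ g(x, s)² ds`, which is integrable in `x`.
  have h1 := hx.integral_mul_translation 0
  simp only [add_zero, inner_zero_left, Complex.ofReal_zero, mul_zero, Complex.exp_zero,
    one_mul] at h1
  rw [integral_complex_ofReal, Complex.ofReal_inj] at h1
  simp only [norm_pow, norm_norm, Function.uncurry_apply_pair]
  rw [← h1]
  exact integral_congr_ae (ae_of_all _ fun s => (pow_two _).symm)

theorem integral_mul_translation_eq [SFinite p]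
    (hg2 : MemLp (Function.uncurry g) 2 (p.prod volume))
    (hF : IsFourierVersion p g ghat) (h : EuclideanSpace ℝ (Fin d))
    (hint : Integrable (fun z : 𝒳 × EuclideanSpace ℝ (Fin d) => g z.1 z.2 * g z.1 (z.2 + h))
      (p.prod volume)) :
    ((∫ z : 𝒳 × EuclideanSpace ℝ (Fin d), g z.1 z.2 * g z.1 (z.2 + h) ∂(p.prod volume) : ℝ) : ℂ) =
      ∫ u, Complex.exp (Complex.I * (inner ℝ h u : ℝ)) * (gam p ghat u : ℂ) := by
  have hI := integrable_norm_sq_prod hg2 hF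
  have hI' : Integrable (Function.uncurry fun (x : 𝒳) (u : EuclideanSpace ℝ (Fin d)) =>
      Complex.exp (Complex.I * (inner ℝ h u : ℝ)) * ((‖ghat x u‖ ^ 2 : ℝ) : ℂ))
      (p.prod volume) := by
    -- The character has modulus one, so integrability of `‖ghat‖²` on the product justifies Fubini.
    refine Integrable.bdd_mul (c := 1) hI.ofReal ?_ (ae_of_all _ fun z => ?_)
    · have h1 : Measurable fun u : EuclideanSpace ℝ (Fin d) =>
          Complex.exp (Complex.I * (inner ℝ h u : ℝ)) := by fun_prop
      exact (h1.comp measurable_snd).aestronglyMeasurable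
    · rw [mul_comm, Complex.norm_exp_ofReal_mul_I]
  rw [integral_prod _ hint, ← integral_complex_ofReal]
  calc _ = ∫ x, (∫ u : EuclideanSpace ℝ (Fin d), Complex.exp (Complex.I * (inner ℝ h u : ℝ)) *
        ((‖ghat x u‖ ^ 2 : ℝ) : ℂ)) ∂p := by
        refine integral_congr_ae ?_
        filter_upwards [hF.2] with x hx
        exact hx.integral_mul_translation h
    _ = ∫ u, ∫ x, Complex.exp (Complex.I * (inner ℝ h u : ℝ)) *
        ((‖ghat x u‖ ^ 2 : ℝ) : ℂ) ∂p := integral_integral_swap hI'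
    _ = _ := by
        refine integral_congr_ae (ae_of_all _ fun u => ?_)
        simp only [gam]
        rw [integral_const_mul, integral_complex_ofReal]

end SpectralFunction

theorem memLp_two_iff_lintegral {α : Type*} {m : MeasurableSpace α} {μ : Measure α} {f : α → ℝ}
    (hf : AEStronglyMeasurable f μ) : MemLp f 2 μ ↔ ∫⁻ x, ENNReal.ofReal (f x ^ 2) ∂μ < ∞ := by
  have hf2 : AEStronglyMeasurable (fun x => f x ^ 2) μ := hf.pow 2
  rw [memLp_two_iff_integrable_sq hf, Integrable, and_iff_right hf2,
    hasFiniteIntegral_iff_ofReal (ae_of_all _ fun x => sq_nonneg (f x))]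

theorem ae_eq_zero_of_lintegral_sq_eq_zero {α : Type*} {m : MeasurableSpace α} {μ : Measure α}
    {f : α → ℝ} (hf : Measurable f) (h : ∫⁻ x, ENNReal.ofReal (f x ^ 2) ∂μ = 0) : f =ᵐ[μ] 0 := by
  rw [lintegral_eq_zero_iff (hf.pow_const 2).ennreal_ofReal] at h
  filter_upwards [h] with x hx
  simpa using hx

/-! ### Consequences of stationarity of the volatility -/

section Field

variable {Ω 𝒳 : Type*} [MeasurableSpace Ω] [MeasurableSpace 𝒳] {d : ℕ}
  {P : Measure Ω} {p : Measure 𝒳}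
  {g : 𝒳 → EuclideanSpace ℝ (Fin d) → ℝ} {σ : EuclideanSpace ℝ (Fin d) → Ω → ℝ}

/-- Only one-point distributions enter. The form with `∫⁻` applies before second moments are known
to be finite. -/
theorem IsStrictlyStationary.lintegral_eq (h : IsStrictlyStationary P σ)
    (hσ : ∀ s, Measurable (σ s)) {f : ℝ → ℝ≥0∞} (hf : Measurable f)
    (s : EuclideanSpace ℝ (Fin d)) : ∫⁻ ω, f (σ s ω) ∂P = ∫⁻ ω, f (σ 0 ω) ∂P := by
  have h1 := h 1 (fun _ => 0) s
  have hm : ∀ t, Measurable fun ω (_ : Fin 1) => σ t ω := fun t =>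
    measurable_pi_lambda _ fun _ => hσ t
  have hf' : Measurable fun y : Fin 1 → ℝ => f (y 0) := hf.comp (measurable_pi_apply 0)
  have h2 := congrArg (fun μ => ∫⁻ y : Fin 1 → ℝ, f (y 0) ∂μ) h1
  simp only [zero_add] at h2
  rwa [lintegral_map hf' (hm s), lintegral_map hf' (hm 0)] at h2

theorem measurePreserving_prod_sub_left [SFinite p] (t : EuclideanSpace ℝ (Fin d)) :
    MeasurePreserving (fun z : 𝒳 × EuclideanSpace ℝ (Fin d) => (z.1, t - z.2))
      (p.prod volume) (p.prod volume) :=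
  (MeasurePreserving.id p).prod (Measure.measurePreserving_sub_left volume t)

theorem measurable_kernel_mul_volatility (hg : Measurable (Function.uncurry g))
    (hσ : Measurable (Function.uncurry σ)) (t : EuclideanSpace ℝ (Fin d)) :
    Measurable fun q : (𝒳 × EuclideanSpace ℝ (Fin d)) × Ω =>
      g q.1.1 (t - q.1.2) * σ q.1.2 q.2 := by
  have h1 : Measurable fun z : 𝒳 × EuclideanSpace ℝ (Fin d) => g z.1 (t - z.2) :=
    hg.comp (measurable_fst.prodMk (measurable_snd.const_sub t))
  exact (h1.comp measurable_fst).mul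
    (hσ.comp ((measurable_snd.comp measurable_fst).prodMk measurable_snd))

theorem memLp_kernel_mul_volatility [SFinite P] (hg : Measurable (Function.uncurry g))
    (hσ : Measurable (Function.uncurry σ)) (t : EuclideanSpace ℝ (Fin d))
    (hgσ : ∫⁻ z, ENNReal.ofReal (g z.1 (t - z.2) ^ 2) *
      (∫⁻ ω, ENNReal.ofReal (σ z.2 ω ^ 2) ∂P) ∂(p.prod volume) < ∞) :
    MemLp (fun q : (𝒳 × EuclideanSpace ℝ (Fin d)) × Ω => g q.1.1 (t - q.1.2) * σ q.1.2 q.2) 2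
      ((p.prod volume).prod P) := by
  have hm := measurable_kernel_mul_volatility hg hσ t
  rw [memLp_two_iff_lintegral hm.aestronglyMeasurable,
    lintegral_prod _ (hm.pow_const 2).ennreal_ofReal.aemeasurable]
  refine (lintegral_congr fun z => ?_).trans_lt hgσ
  have hσs : Measurable (σ z.2) := hσ.comp measurable_prodMk_left
  rw [← lintegral_const_mul _ (hσs.pow_const 2).ennreal_ofReal]
  refine lintegral_congr fun ω => ?_
  rw [mul_pow, ENNReal.ofReal_mul (sq_nonneg _)]

/-- Finiteness of the second moment condition forces `g ∈ L²` and `σ(0) ∈ L²`. -/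
theorem memLp_kernel_and_volatility [SFinite p] (hg : Measurable (Function.uncurry g))
    (hg0 : ¬ Function.uncurry g =ᵐ[p.prod volume] 0)
    (hσ : Measurable (Function.uncurry σ)) (hσstat : IsStrictlyStationary P σ)
    (hσ0 : ¬ σ 0 =ᵐ[P] 0)
    (hgσ : ∀ t, ∫⁻ z, ENNReal.ofReal (g z.1 (t - z.2) ^ 2) *
      (∫⁻ ω, ENNReal.ofReal (σ z.2 ω ^ 2) ∂P) ∂(p.prod volume) < ∞) :
    MemLp (Function.uncurry g) 2 (p.prod volume) ∧ MemLp (σ 0) 2 P := by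
  have hσs : ∀ s, Measurable (σ s) := fun s => hσ.comp measurable_prodMk_left
  have h1 := hgσ 0
  have h2 := hσstat.lintegral_eq hσs (f := fun y => ENNReal.ofReal (y ^ 2)) (by fun_prop)
  have h3 : Measurable fun z : 𝒳 × EuclideanSpace ℝ (Fin d) =>
      ENNReal.ofReal (Function.uncurry g z ^ 2) := (hg.pow_const 2).ennreal_ofReal
  have h4 := measurePreserving_prod_sub_left (p := p) (0 : EuclideanSpace ℝ (Fin d))
  simp_rw [h2] at h1
  have h6 : Measurable fun z : 𝒳 × EuclideanSpace ℝ (Fin d) =>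
      ENNReal.ofReal (g z.1 (0 - z.2) ^ 2) := h3.comp h4.measurable
  rw [lintegral_mul_const _ h6] at h1
  have h5 := h4.lintegral_comp h3
  simp only [Function.uncurry_apply_pair] at h5
  rw [h5, ENNReal.mul_lt_top_iff] at h1
  -- A finite product in `ℝ≥0∞` has two finite factors or a zero one; nontriviality of `g` and `σ 0`
  -- excludes zero.
  rcases h1 with ⟨ha, hb⟩ | ha | hb
  · exact ⟨(memLp_two_iff_lintegral hg.aestronglyMeasurable).2 ha,
      (memLp_two_iff_lintegral (hσs 0).aestronglyMeasurable).2 hb⟩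
  · exact absurd (ae_eq_zero_of_lintegral_sq_eq_zero hg ha) hg0
  · exact absurd (ae_eq_zero_of_lintegral_sq_eq_zero (hσs 0) hb) hσ0

theorem IsStrictlyStationary.integral_sq_eq (h : IsStrictlyStationary P σ)
    (hσ : ∀ s, Measurable (σ s)) (s : EuclideanSpace ℝ (Fin d)) :
    ∫ ω, σ s ω ^ 2 ∂P = ∫ ω, σ 0 ω ^ 2 ∂P := by
  rw [integral_eq_lintegral_of_nonneg_ae (ae_of_all _ fun _ => sq_nonneg _)
    ((hσ s).pow_const 2).aestronglyMeasurable,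
    integral_eq_lintegral_of_nonneg_ae (ae_of_all _ fun _ => sq_nonneg _)
    ((hσ 0).pow_const 2).aestronglyMeasurable,
    h.lintegral_eq hσ (f := fun y => ENNReal.ofReal (y ^ 2)) (by fun_prop)]

/-- Integrating over `ω` first leaves the constant `E σ(0)²`; the reflection `s ↦ t - s` then
exposes the autocorrelation of `g` at lag `s - t`. -/
theorem integral_kernel_mul_volatility_mul [SFinite p] [SFinite P]
    (hg : Measurable (Function.uncurry g))
    (hσ : Measurable (Function.uncurry σ)) (hσstat : IsStrictlyStationary P σ)
    (hΦ : ∀ t, MemLp (fun q : (𝒳 × EuclideanSpace ℝ (Fin d)) × Ω =>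
      g q.1.1 (t - q.1.2) * σ q.1.2 q.2) 2 ((p.prod volume).prod P))
    (s t : EuclideanSpace ℝ (Fin d)) :
    ∫ q : (𝒳 × EuclideanSpace ℝ (Fin d)) × Ω, (g q.1.1 (s - q.1.2) * σ q.1.2 q.2) *
      (g q.1.1 (t - q.1.2) * σ q.1.2 q.2) ∂((p.prod volume).prod P) =
    (∫ ω, σ 0 ω ^ 2 ∂P) * ∫ z : 𝒳 × EuclideanSpace ℝ (Fin d),
      g z.1 z.2 * g z.1 (z.2 + (s - t)) ∂(p.prod volume) := by
  have hσs : ∀ s, Measurable (σ s) := fun s => hσ.comp measurable_prodMk_left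
  have hmp := measurePreserving_prod_sub_left (p := p) t
  have hm : Measurable fun z : 𝒳 × EuclideanSpace ℝ (Fin d) =>
      g z.1 z.2 * g z.1 (z.2 + (s - t)) :=
    hg.mul (hg.comp (measurable_fst.prodMk (measurable_snd.add_const (s - t))))
  rw [integral_prod _ ((hΦ s).integrable_fun_mul (hΦ t))]
  have h1 : ∀ z : 𝒳 × EuclideanSpace ℝ (Fin d), ∫ ω, (g z.1 (s - z.2) * σ z.2 ω) *
      (g z.1 (t - z.2) * σ z.2 ω) ∂P =
      (∫ ω, σ 0 ω ^ 2 ∂P) * (g z.1 (t - z.2) * g z.1 (t - z.2 + (s - t))) := fun z => by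
    rw [← hσstat.integral_sq_eq hσs z.2, ← integral_mul_const]
    refine integral_congr_ae (ae_of_all _ fun ω => ?_)
    rw [show t - z.2 + (s - t) = s - z.2 by abel]
    ring
  simp_rw [h1]
  rw [integral_const_mul]
  congr 1
  conv_rhs => rw [← hmp.map_eq]
  exact (integral_map hmp.measurable.aemeasurable hm.aestronglyMeasurable).symm

end Field

end VMMMA
-- The main theorem
open VMMMA in
theorem mainTheorem7 {Ω 𝒳 : Type*} [MeasurableSpace Ω] [MeasurableSpace 𝒳] {d : ℕ} [NeZero d]
    (P : Measure Ω) [IsProbabilityMeasure P] (p : Measure 𝒳) [IsProbabilityMeasure p]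
    (W : Set (𝒳 × EuclideanSpace ℝ (Fin d)) → Ω → ℝ)
    (hW : IsGaussianWhiteNoise P (p.prod volume) W)
    (F : Filtration ℝ ‹MeasurableSpace Ω›)
    (hF : IsNoiseFiltration P (p.prod volume) W (fun z => time z.2) F)
    (g : 𝒳 → EuclideanSpace ℝ (Fin d) → ℝ) (hg : Measurable (Function.uncurry g))
    (hg0 : ¬ Function.uncurry g =ᵐ[p.prod volume] 0)
    (σ : EuclideanSpace ℝ (Fin d) → Ω → ℝ)
    (hσpred : Measurable[predictableSigma time F] (Function.uncurry σ))
    (hσstat : IsStrictlyStationary P σ)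
    (hσW : Indep (⨆ s, MeasurableSpace.comap (σ s) inferInstance)
      (noiseSigma (p.prod volume) W Set.univ) P)
    (hσ0 : ¬ σ 0 =ᵐ[P] 0)
    (hgσ : ∀ t, ∫⁻ z, ENNReal.ofReal (g z.1 (t - z.2) ^ 2) *
      (∫⁻ ω, ENNReal.ofReal (σ z.2 ω ^ 2) ∂P) ∂(p.prod volume) < ∞) :
    (∃ X, IsVMMMAField P p F W g σ X) ∧ (∃ ghat, IsFourierVersion p g ghat) ∧
    ∀ X ghat, IsVMMMAField P p F W g σ X → IsFourierVersion p g ghat →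
      (∀ t, 0 < Var[X t; P]) ∧
      (∀ᵐ u, Integrable (fun x => ‖ghat x u‖ ^ 2) p) ∧ Integrable (gam p ghat) ∧
      (∃ C : ℝ, 0 < C ∧ ∀ h, ((autocorrelation P X h : ℝ) : ℂ) =
        (C : ℂ) * ((((2 * Real.pi) ^ (-(d : ℝ) / 2) : ℝ) : ℂ) *
          ∫ u, Complex.exp (Complex.I * (inner ℝ h u : ℝ)) * (gam p ghat u : ℂ))) ∧
      (∃ C : ℝ, 0 < C ∧ ∀ f : EuclideanSpace ℝ (Fin d) → ℝ,
        IsSpectralDensity P X f ↔ f =ᵐ[volume] fun u => C * gam p ghat u) := by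
  have hτ : Measurable (time : EuclideanSpace ℝ (Fin d) → ℝ) := by unfold time; fun_prop
  have hτ' : Measurable fun z : 𝒳 × EuclideanSpace ℝ (Fin d) => time z.2 :=
    hτ.comp measurable_snd
  have hσ : Measurable (Function.uncurry σ) := hσpred.mono (predictableSigma_le hτ F) le_rfl
  have hσs : ∀ s, Measurable (σ s) := fun s => hσ.comp measurable_prodMk_left
  obtain ⟨hg2, hσ2⟩ := memLp_kernel_and_volatility hg hg0 hσ hσstat hσ0 hgσ
  have hΦ := fun t => memLp_kernel_mul_volatility hg hσ t (hgσ t)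
  have hΦpred : ∀ t, Measurable[predictableSigma (fun z : 𝒳 × EuclideanSpace ℝ (Fin d) =>
      time z.2) F] fun q : (𝒳 × EuclideanSpace ℝ (Fin d)) × Ω =>
      g q.1.1 (t - q.1.2) * σ q.1.2 q.2 := fun t => by
    have h1 : Measurable fun z : 𝒳 × EuclideanSpace ℝ (Fin d) => g z.1 (t - z.2) :=
      hg.comp (measurable_fst.prodMk (measurable_snd.const_sub t))
    exact (measurable_predictable_fst h1).mul
      (hσpred.comp (measurable_predictable_comp measurable_snd fun _ => rfl))
  refine ⟨?_, exists_isFourierVersion p g hg (ae_memLp_of_memLp_uncurry hg hg2), ?_⟩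
  · choose X hX using fun t => exists_isWalshIntegral hτ' hW hF (hΦpred t) (hΦ t)
    exact ⟨X, hX⟩
  intro X ghat hX hghat
  set M : ℝ := ∫ ω, σ 0 ω ^ 2 ∂P with hM
  set γ : EuclideanSpace ℝ (Fin d) → ℝ := gam p ghat with hγ
  set K : EuclideanSpace ℝ (Fin d) → ℂ := fun h =>
    ∫ u, Complex.exp (Complex.I * (inner ℝ h u : ℝ)) * (γ u : ℂ) with hK
  have hI := integrable_norm_sq_prod hg2 hghat
  have hγint : Integrable γ := hI.integral_prod_right
  have hγ0 : ∀ u, 0 ≤ γ u := fun u => integral_nonneg fun x => by positivity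
  have hX2 : ∀ t, MemLp (X t) 2 P := fun t => (hX t).1
  have hX0 : ∀ t, ∫ ω, X t ω ∂P = 0 := fun t => (hX t).integral_eq_zero hτ' hW hF
  have hMpos : 0 < M := by
    refine lt_of_le_of_ne (integral_nonneg fun ω => sq_nonneg _) fun h => hσ0 ?_
    rw [hM, eq_comm, integral_eq_zero_iff_of_nonneg (fun ω => sq_nonneg _)
      hσ2.integrable_sq] at h
    filter_upwards [h] with ω hω
    simpa using hω
  have hcovK : ∀ s t, ((cov[X s, X t; P] : ℝ) : ℂ) = M * K (s - t) := fun s t => by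
    have hmp : MeasurePreserving (fun z : 𝒳 × EuclideanSpace ℝ (Fin d) =>
        (z.1, z.2 + (s - t))) (p.prod volume) (p.prod volume) :=
      (MeasurePreserving.id p).prod (measurePreserving_add_right volume (s - t))
    rw [covariance_eq_sub (hX2 s) (hX2 t), hX0, zero_mul, sub_zero]
    simp only [Pi.mul_apply]
    rw [(hX s).integral_mul hτ' hW hF (hΦ s) (hΦ t) (hX t),
      integral_kernel_mul_volatility_mul hg hσ hσstat hΦ s t, Complex.ofReal_mul,
      integral_mul_translation_eq hg2 hghat (s - t)
        (hg2.integrable_fun_mul (hg2.comp_measurePreserving hmp))]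
  set G : ℝ := ∫ u, γ u with hG
  have hK0 : K 0 = G := by
    simp only [hK, hG, inner_zero_left, Complex.ofReal_zero, mul_zero, Complex.exp_zero, one_mul]
    exact integral_complex_ofReal
  -- At lag zero `∫ γ` is the squared `L²` norm of `g`.
  have hGpos : 0 < G := by
    have h1 := integral_mul_translation_eq hg2 hghat 0
      (by simpa [Function.uncurry] using hg2.integrable_fun_mul hg2)
    rw [show (∫ u, Complex.exp (Complex.I * (inner ℝ (0 : EuclideanSpace ℝ (Fin d)) u : ℝ)) *
      (gam p ghat u : ℂ)) = G from hK0, Complex.ofReal_inj] at h1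
    rw [← h1]
    simp only [add_zero, ← pow_two]
    refine lt_of_le_of_ne (integral_nonneg fun z => sq_nonneg _) fun h => hg0 ?_
    have h' : ∫ z, Function.uncurry g z ^ 2 ∂(p.prod volume) = 0 := h.symm
    rw [integral_eq_zero_iff_of_nonneg (fun z => sq_nonneg _) hg2.integrable_sq] at h'
    filter_upwards [h'] with z hz
    simpa [Function.uncurry] using hz
  have hvar : ∀ t, Var[X t; P] = M * G := fun t => by
    rw [← covariance_self (hX2 t).1.aemeasurable]
    have := hcovK t t
    rw [sub_self, hK0] at this
    exact_mod_cast this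
  refine ⟨fun t => by rw [hvar]; positivity, hI.prod_left_ae, hγint, ?_, ?_⟩
  -- The correlation is `M K(h) / (M G)`, so `M` cancels; the power of `2π` undoes the normalization
  -- of the inverse transform.
  · refine ⟨(2 * Real.pi) ^ ((d : ℝ) / 2) / G, by positivity, fun h => ?_⟩
    have h1 : (((2 * Real.pi) ^ ((d : ℝ) / 2) : ℝ) : ℂ) *
        (((2 * Real.pi) ^ (-(d : ℝ) / 2) : ℝ) : ℂ) = 1 := by
      rw [← Complex.ofReal_mul, ← Real.rpow_add (by positivity)]
      simp [neg_div]
    have hM' : (M : ℂ) ≠ 0 := by exact_mod_cast hMpos.ne'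
    have hG' : (G : ℂ) ≠ 0 := by exact_mod_cast hGpos.ne'
    rw [autocorrelation, hvar, hvar, Real.mul_self_sqrt (by positivity), Complex.ofReal_div,
      hcovK, sub_zero, Complex.ofReal_div, Complex.ofReal_mul, ← mul_assoc, div_mul_eq_mul_div, h1]
    field_simp
    rfl
  -- The factor of proportionality is the second moment `M` of `σ 0`, read off from `hcovK`.
  · refine ⟨M, hMpos, fun f => ⟨?_, fun hf => ?_⟩⟩
    · rintro ⟨-, -, hf0, hfint, hfcov⟩
      refine ae_eq_of_fourier_eq hfint (hγint.const_mul M) hf0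
        (ae_of_all _ fun u => mul_nonneg hMpos.le (hγ0 u)) fun h => ?_
      rw [← hfcov 0 h, hcovK, zero_add, sub_zero, ← integral_const_mul]
      refine integral_congr_ae (ae_of_all _ fun u => ?_)
      push_cast
      ring
    · refine ⟨hX2, fun s t => by rw [hX0, hX0], ?_, ?_, fun t h => ?_⟩
      · filter_upwards [hf] with u hu
        rw [hu]
        exact mul_nonneg hMpos.le (hγ0 u)
      · exact (integrable_congr hf).2 (hγint.const_mul M)
      · rw [hcovK, add_sub_cancel_left, ← integral_const_mul]
        refine integral_congr_ae ?_
        filter_upwards [hf] with u hu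
        rw [hu]
        push_cast
        ring
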